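/- Let $q>0$ and $c\in\mathbb R$, and consider, for $p=1$, the equation for the angular part $\omega$ of separable solutions $u=r^{-1/q}\omega(\sigma)$ in $\mathbb R^2\setminus\{0\}$ of $\operatorname{div}(|Du|^{-1}Du)+|u|^{q-1}u-\frac{c}{|x|}|u|^{-1}u=0$, that is $$\frac{d}{d\sigma}\left[\frac{\omega'}{\sqrt{q^{-2}\omega^2+\omega'^2}}\right]-\frac1q\,\frac{\omega}{\sqrt{q^{-2}\omega^2+\omega'^2}}+|\omega|^{q-1}\omega-c\,\frac{\omega}{|\omega|}=0. \qquad(\ast)$$ A solution is a $2\pi$-periodic $C^1$ function $\omega:\mathbb R\to\mathbb R$ satisfying $(\ast)$ at every point at which $(\ast)$ is meaningful, i.e. where $\omega\neq0$, and, if $c=0$, also where $\omega=0\ne\omega'$. Let $\mathcal E$ be the set of solutions that take both positive and negative values, and $\mathcal E^+$ the set of solutions that are nonnegative and do not vanish identically on any open interval. Then: (i) If $c\neq0$, or $c=0$ and $q>1$, then $\mathcal E=\emptyset$. If $c=0$ and $q\le1$, then $\mathcal E=\{\omega_0(\cdot+\psi):\psi\in\mathbb R\}$, where $\omega_0(\sigma)=2^{1/q}|\sin\sigma|^{(1-q)/q}\sin\sigma$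 is a $C^1$ solution of $(\ast)$. (ii) If $c\le-1$, then $\mathcal E^+=\emptyset$. If $-1<c<0$, then $\mathcal E^+$ consists of the constant function $(c+1)^{1/q}$ only. If $c>0$, then $$\mathcal E^+=\{(c+1)^{1/q}\}\cup\bigcup_{k\in\mathbb N,\ k_1\le k\le k_2}\{\omega_k^+(\cdot+\psi):\psi\in\mathbb R\},$$ where $\omega_k^+$ is an everywhere positive function with least period $2\pi/k$, $k_1$ is the smallest integer strictly greater than $(c+1)^{1/2}$, and $k_2$ is the largest integer strictly smaller than $$\frac{\pi}{2}\left(\int_0^{\pi/2}\sqrt{\frac{\cos\theta}{\cos\theta+2c}}\,d\theta\right)^{-1}$$ (the union is empty if $k_2<k_1$). If $c=0$, then $$\mathcal E^+=\{1\}\cup\bigcup_{K\in(0,1)}\{\omega_K^+(\cdot+\psi):\psi\in\mathbb R\}\cup\begin{cases}\emptyset&\text{if }q\ge1,\\ \{\omega_0^+(\cdot+\psi):\psi\in\mathbb R\}&\text{if }q<1,\end{cases}$$ where $\omega_K^+(\sigma)=\left(\sqrt{1-K^2\sin^2\sigma}-K\cos\sigma\right)^{1/q}$ and $\omega_0^+(\sigma)=(2|\sin\sigma|)^{1/q}$.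 -/

import Mathlib

noncomputable section

namespace SeparableSolutions

/-- The exponent `β_q = p / (q + 1 - p)` of the separable solutions `r ^ (-β_q) * ω σ`. -/
def betaQ (p q : ℝ) : ℝ := p / (q + 1 - p)

/-- The coefficient `λ_q = β_q (q β_q - 2)`. -/
def lambdaQ (p q : ℝ) : ℝ := betaQ p q * (q * betaQ p q - 2)

/-- The weight `(β_q² ω² + (dω/dσ)²) ^ ((p - 2) / 2)` at the angle `σ`. -/
def weight (p q : ℝ) (ω : ℝ → ℝ) (σ : ℝ) : ℝ :=
  ((betaQ p q) ^ 2 * (ω σ) ^ 2 + (deriv ω σ) ^ 2) ^ ((p - 2) / 2)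

/-- The flux `(β_q² ω² + (dω/dσ)²) ^ ((p - 2) / 2) * dω/dσ`. -/
def flux (p q : ℝ) (ω : ℝ → ℝ) (σ : ℝ) : ℝ := weight p q ω σ * deriv ω σ

/-- The equation
`(flux)' + λ_q * weight * ω + |ω| ^ (q - 1) * ω - c * |ω| ^ (p - 2) * ω = 0` at the angle `σ`,
the derivative of the flux being assumed to exist. -/
def EquationAt (p q c : ℝ) (ω : ℝ → ℝ) (σ : ℝ) : Prop :=
  DifferentiableAt ℝ (flux p q ω) σ ∧
    deriv (flux p q ω) σ + lambdaQ p q * weight p q ω σ * ω σ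
      + |ω σ| ^ (q - 1) * ω σ - c * |ω σ| ^ (p - 2) * ω σ = 0

/-- All the terms of the equation are meaningful at `σ`. If `p > 1` they all extend by continuity
to `ω = 0` and to `ω = dω/dσ = 0`. If `p = 1`, the term `c ω / |ω|` has no meaning at `ω = 0`
unless `c = 0`, and the quotients by `√(β_q² ω² + (dω/dσ)²)` have none at `ω = dω/dσ = 0`. -/
def Meaningful (p c : ℝ) (ω : ℝ → ℝ) (σ : ℝ) : Prop :=
  1 < p ∨ ω σ ≠ 0 ∨ (c = 0 ∧ deriv ω σ ≠ 0)

/-- Solutions on the circle: `2π`-periodic `C¹` functions which satisfy the equation at every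
point at which it is meaningful. -/
structure IsSolution (p q c : ℝ) (ω : ℝ → ℝ) : Prop where
  contDiff : ContDiff ℝ 1 ω
  periodic : Function.Periodic ω (2 * Real.pi)
  equation : ∀ σ, Meaningful p c ω σ → EquationAt p q c ω σ

/-- The set of sign changing solutions. -/
def signChangingSolutions (p q c : ℝ) : Set (ℝ → ℝ) :=
  {ω | IsSolution p q c ω ∧ (∃ σ, 0 < ω σ) ∧ ∃ σ, ω σ < 0}

/-- The set of positive solutions: zeros are allowed, but a positive solution does not
vanish identically on any open interval. -/
def positiveSolutions (p q c : ℝ) : Set (ℝ → ℝ) :=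
  {ω | IsSolution p q c ω ∧ (∀ σ, 0 ≤ ω σ) ∧ Dense {σ | 0 < ω σ}}

/-- The set of all rotations `f (· + ψ)` of `f`. -/
def rotations (f : ℝ → ℝ) : Set (ℝ → ℝ) := Set.range fun ψ : ℝ => fun σ : ℝ => f (σ + ψ)

/-- `T` is the least (positive) period of `f`; constant functions have no least period. -/
def IsLeastPeriod (f : ℝ → ℝ) (T : ℝ) : Prop :=
  IsLeast {t : ℝ | 0 < t ∧ Function.Periodic f t} T

/-- `ω_0 = 2 ^ (1 / q) |sin σ| ^ ((1 - q) / q) sin σ`. -/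
def omegaZero (q : ℝ) (σ : ℝ) : ℝ :=
  (2 : ℝ) ^ (1 / q) * |Real.sin σ| ^ ((1 - q) / q) * Real.sin σ

/-- `ω_0⁺ = (2 |sin σ|) ^ (1 / q)`. -/
def omegaZeroPos (q : ℝ) (σ : ℝ) : ℝ := (2 * |Real.sin σ|) ^ (1 / q)

/-- `ω_K⁺ = (√(1 - K² sin² σ) - K cos σ) ^ (1 / q)`. -/
def omegaK (q K : ℝ) (σ : ℝ) : ℝ :=
  (√(1 - K ^ 2 * (Real.sin σ) ^ 2) - K * Real.cos σ) ^ (1 / q)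

/-- The integral `∫_0^{π/2} √(cos θ / (cos θ + 2c)) dθ`. -/
def periodIntegral (c : ℝ) : ℝ :=
  ∫ θ in (0 : ℝ)..(Real.pi / 2), √(Real.cos θ / (Real.cos θ + 2 * c))

end SeparableSolutions

end

namespace SeparableSolutions

open Real Set Filter Topology

/-! Where `ω > 0`, put `w = ω ^ q` and let `S` be the flux. The exponent `q` drops out: with `C =
√(1 - S²)` the equation becomes the autonomous system `w' = w S / C`, `S' = C - w + c`, which
conserves `w (C + c - w / 2)` (`IsProfileAt.hasDerivAt_energy`).

Suppose a solution has a zero and a positive value. On a positivity interval bounded by zeros the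
energy vanishes, so `C + c = w / 2`. For `c > 0` this keeps `w` above `2c`; for `c < 0` it bounds
`w' / w`, so `w` cannot reach zero. For `c = 0` it gives `(arcsin S)' = -1`, hence `w = 2 sin (x -
a)` on an interval of length `π` (`component_eq`). Gluing such arcs gives `omegaZero` and
`omegaZeroPos`; differentiability at the zeros restricts `q`.

Suppose now that `ω` never vanishes. Unless `w` is constant, its extrema `m < M` satisfy `m + M = 2
(1 + c)`, and the orbit is labelled by `y ∈ (0, 1)`, the least value of `C`, where `m M = (y + c)²`
(`constant_or_exists_min`). Conservation of energy reads `S'² = (C - y) (C + y + 2c)`. Writing `S =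
√(1 - y²) sin t` turns this into `dσ/dt = √((C + y) / (C + y + 2c))`, which integrates to an
explicit profile of period `profilePeriod c y` (`exists_profile`); `profile_unique` shows that there
is no other.

A `2π`-periodic orbit therefore requires `2π = n * profilePeriod c y` with `n ≥ 1`. The period
exceeds `2π` if `c < 0` and equals `2π` for every `y` if `c = 0`. If `c > 0` it increases strictly
from `4 * periodIntegral c` at `y = 0` to `2π / √(c + 1)` at `y = 1`, so each admissible `n` comes
from exactly one `y`. -/

/-- The first order system satisfied by `w = ω ^ q` and the flux `S` of a positive solution `ω`
of the equation with `p = 1`. It does not involve `q`. -/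
structure IsProfileAt (c : ℝ) (w S : ℝ → ℝ) (σ : ℝ) : Prop where
  pos : 0 < w σ
  sq_lt : S σ ^ 2 < 1
  deriv_w : HasDerivAt w (w σ * S σ / √(1 - S σ ^ 2)) σ
  deriv_S : HasDerivAt S (√(1 - S σ ^ 2) - w σ + c) σ

lemma weight_one {q : ℝ} (ω : ℝ → ℝ) (σ : ℝ) :
    weight 1 q ω σ = (√((1 / q) ^ 2 * ω σ ^ 2 + deriv ω σ ^ 2))⁻¹ := by
  have h : (0 : ℝ) ≤ (1 / q) ^ 2 * ω σ ^ 2 + deriv ω σ ^ 2 := by positivity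
  simp only [weight, betaQ]
  rw [show q + 1 - 1 = q by ring, show ((1 : ℝ) - 2) / 2 = -(1 / 2) by norm_num,
    rpow_neg h, ← sqrt_eq_rpow]

lemma lambdaQ_one {q : ℝ} (hq : q ≠ 0) : lambdaQ 1 q = -(1 / q) := by
  simp only [lambdaQ, betaQ]
  rw [show q + 1 - 1 = q by ring]
  field_simp
  norm_num

/-! ### Invariance under sign change and rotation -/

section Symmetries

variable {q c : ℝ} {ω : ℝ → ℝ} {σ : ℝ}

lemma weight_neg : weight 1 q (-ω) = weight 1 q ω := by
  funext σ
  simp [weight_one, deriv.neg']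

lemma flux_neg : flux 1 q (-ω) = -flux 1 q ω := by
  funext σ
  simp [flux, weight_neg, deriv.neg']

lemma EquationAt.neg (h : EquationAt 1 q c ω σ) : EquationAt 1 q c (-ω) σ := by
  obtain ⟨h1, h2⟩ := h
  rw [EquationAt, flux_neg, weight_neg]
  refine ⟨h1.neg, ?_⟩
  rw [deriv.neg]
  simp only [Pi.neg_apply, abs_neg]
  linarith

lemma IsSolution.neg (h : IsSolution 1 q c ω) : IsSolution 1 q c (-ω) where
  contDiff := h.contDiff.neg
  periodic σ := by simp [h.periodic σ]
  equation σ hσ := by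
    refine (h.equation σ ?_).neg
    simpa [Meaningful, deriv.neg'] using hσ

lemma weight_shift (ψ : ℝ) :
    weight 1 q (fun x => ω (x + ψ)) = fun x => weight 1 q ω (x + ψ) := by
  funext σ
  simp [weight_one, deriv_comp_add_const]

lemma flux_shift (ψ : ℝ) : flux 1 q (fun x => ω (x + ψ)) = fun x => flux 1 q ω (x + ψ) := by
  funext σ
  simp [flux, weight_shift, deriv_comp_add_const]

lemma EquationAt.shift {ψ : ℝ} (h : EquationAt 1 q c ω (σ + ψ)) :
    EquationAt 1 q c (fun x => ω (x + ψ)) σ := by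
  obtain ⟨h1, h2⟩ := h
  rw [EquationAt, flux_shift, weight_shift]
  refine ⟨(h1.hasDerivAt.comp_add_const _ _).differentiableAt, ?_⟩
  rw [deriv_comp_add_const]
  exact h2

lemma IsSolution.shift (h : IsSolution 1 q c ω) (ψ : ℝ) :
    IsSolution 1 q c (fun x => ω (x + ψ)) where
  contDiff := h.contDiff.comp (contDiff_id.add contDiff_const)
  periodic σ := by
    have := h.periodic (σ + ψ)
    simpa [add_right_comm] using this
  equation σ hσ := by
    refine (h.equation (σ + ψ) ?_).shift
    simpa [Meaningful, deriv_comp_add_const] using hσ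

lemma IsProfileAt.shift {w S : ℝ → ℝ} {ψ : ℝ} (h : IsProfileAt c w S (σ + ψ)) :
    IsProfileAt c (fun x => w (x + ψ)) (fun x => S (x + ψ)) σ where
  pos := h.pos
  sq_lt := h.sq_lt
  deriv_w := h.deriv_w.comp_add_const _ _
  deriv_S := h.deriv_S.comp_add_const _ _

lemma flux_periodic (h : Function.Periodic ω (2 * π)) :
    Function.Periodic (flux 1 q ω) (2 * π) := by
  intro σ
  have h1 := congrFun (flux_shift (q := q) (ω := ω) (2 * π)) σ
  rw [show (fun x => ω (x + 2 * π)) = ω from funext h] at h1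
  exact h1.symm

end Symmetries

/-! ### Equivalence with the first order system, and its energy -/

section Conversion

variable {q c : ℝ} {ω w S : ℝ → ℝ} {σ : ℝ}

/-- In polar form `ω / q = N cos θ`, `ω' = N sin θ`, the flux is `sin θ`, so `√(1 - S²) = cos θ = ω
/ (q N)` and `(ω ^ q)' / ω ^ q = q ω' / ω = tan θ`. -/
lemma IsSolution.isProfileAt (hq : 0 < q) (h : IsSolution 1 q c ω) (hσ : 0 < ω σ) :
    IsProfileAt c (fun x => ω x ^ q) (flux 1 q ω) σ := by
  obtain ⟨e1, e2⟩ := h.equation σ (Or.inr (Or.inl hσ.ne'))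
  have hd : HasDerivAt ω (deriv ω σ) σ := (h.contDiff.differentiable one_ne_zero σ).hasDerivAt
  set a := ω σ with ha
  set d := deriv ω σ with hd'
  set N := √((1 / q) ^ 2 * a ^ 2 + d ^ 2) with hN
  have hNpos : 0 < N := sqrt_pos.2 (by positivity)
  have hN2 : N ^ 2 = (1 / q) ^ 2 * a ^ 2 + d ^ 2 := sq_sqrt (by positivity)
  have hw : weight 1 q ω σ = N⁻¹ := weight_one ω σ
  have hS : flux 1 q ω σ = d / N := by
    rw [flux, hw, ← hd']; ring
  have h1S : 1 - (d / N) ^ 2 = (a / (q * N)) ^ 2 := by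
    field_simp
    field_simp at hN2
    linear_combination hN2
  have hC : √(1 - (d / N) ^ 2) = a / (q * N) := by
    rw [h1S, sqrt_sq (by positivity)]
  have hapos : 0 < a ^ q := rpow_pos_of_pos hσ q
  refine ⟨hapos, ?_, ?_, ?_⟩
  · rw [hS]
    have : 0 < (a / (q * N)) ^ 2 := by positivity
    linarith
  · rw [hS, hC]
    have := hd.rpow_const (p := q) (Or.inl hσ.ne')
    convert this using 1
    rw [rpow_sub_one hσ.ne', ← ha]
    field_simp
  · rw [hS, hC]
    have hA := e1.hasDerivAt
    rw [hw, lambdaQ_one hq.ne', abs_of_pos hσ, rpow_sub_one hσ.ne',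
      show (1 : ℝ) - 2 = -1 by norm_num, rpow_neg_one] at e2
    have e3 : a ^ q / a * a = a ^ q := by field_simp
    have e4 : c * a⁻¹ * a = c := by field_simp
    rw [e3, e4] at e2
    have e5 : a / (q * N) = 1 / q * N⁻¹ * a := by field_simp
    refine hA.congr_deriv ?_
    rw [e5]
    linarith

lemma IsProfileAt.sqrt_pos (h : IsProfileAt c w S σ) : 0 < √(1 - S σ ^ 2) :=
  Real.sqrt_pos.2 (by linarith [h.sq_lt])

lemma IsProfileAt.sq_sqrt (h : IsProfileAt c w S σ) : √(1 - S σ ^ 2) ^ 2 = 1 - S σ ^ 2 :=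
  Real.sq_sqrt (by linarith [h.sq_lt])

lemma IsProfileAt.sqrt_le_one (_h : IsProfileAt c w S σ) : √(1 - S σ ^ 2) ≤ 1 := by
  rw [Real.sqrt_le_left zero_le_one]
  linarith [sq_nonneg (S σ)]

lemma IsProfileAt.hasDerivAt_rpow (hq : 0 < q) (h : IsProfileAt c w S σ) :
    HasDerivAt (fun x => w x ^ (1 / q))
      (1 / q * w σ ^ (1 / q) * S σ / √(1 - S σ ^ 2)) σ := by
  have h1 := h.deriv_w.rpow_const (p := 1 / q) (Or.inl h.pos.ne')
  have := h.pos.ne'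
  have := h.sqrt_pos.ne'
  convert h1 using 1
  rw [rpow_sub_one h.pos.ne']
  field_simp

lemma IsProfileAt.weight_rpow (hq : 0 < q) (h : IsProfileAt c w S σ) :
    weight 1 q (fun x => w x ^ (1 / q)) σ = √(1 - S σ ^ 2) / (1 / q * w σ ^ (1 / q)) := by
  rw [weight_one, (h.hasDerivAt_rpow hq).deriv]
  have hC := h.sqrt_pos
  have hC2 := h.sq_sqrt
  set C := √(1 - S σ ^ 2)
  have ha : 0 < w σ ^ (1 / q) := rpow_pos_of_pos h.pos _
  set a := w σ ^ (1 / q)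
  have : (1 / q) ^ 2 * a ^ 2 + (1 / q * a * S σ / C) ^ 2 = (1 / q * a / C) ^ 2 := by
    field_simp
    linear_combination hC2
  rw [this, Real.sqrt_sq (by positivity), inv_div]

lemma IsProfileAt.flux_rpow (hq : 0 < q) (h : IsProfileAt c w S σ) :
    flux 1 q (fun x => w x ^ (1 / q)) σ = S σ := by
  rw [flux, h.weight_rpow hq, (h.hasDerivAt_rpow hq).deriv]
  have hC := h.sqrt_pos
  have ha : 0 < w σ ^ (1 / q) := rpow_pos_of_pos h.pos _
  field_simp

/-- The system is needed on a neighbourhood, not only at `σ`, because the equation differentiates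
the flux, which must agree with `S` near `σ`. -/
lemma equationAt_of_isProfileAt (hq : 0 < q) (h : ∀ᶠ x in 𝓝 σ, IsProfileAt c w S x) :
    EquationAt 1 q c (fun x => w x ^ (1 / q)) σ := by
  have h0 := h.self_of_nhds
  have hflux : flux 1 q (fun x => w x ^ (1 / q)) =ᶠ[𝓝 σ] S := by
    filter_upwards [h] with x hx using hx.flux_rpow hq
  have hd := h0.deriv_S.congr_of_eventuallyEq hflux
  refine ⟨hd.differentiableAt, ?_⟩
  rw [hd.deriv, h0.weight_rpow hq, lambdaQ_one hq.ne']
  have ha : 0 < w σ ^ (1 / q) := rpow_pos_of_pos h0.pos _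
  have haq : (w σ ^ (1 / q)) ^ q = w σ := by
    rw [← rpow_mul h0.pos.le, one_div_mul_cancel hq.ne', rpow_one]
  simp only
  rw [abs_of_pos ha, rpow_sub_one ha.ne', haq, show (1 : ℝ) - 2 = -1 by norm_num, rpow_neg_one]
  field_simp
  ring

lemma EquationAt.congr {ω' : ℝ → ℝ} (h : EquationAt 1 q c ω σ) (he : ω =ᶠ[𝓝 σ] ω') :
    EquationAt 1 q c ω' σ := by
  have hw : weight 1 q ω =ᶠ[𝓝 σ] weight 1 q ω' := by
    filter_upwards [he, he.deriv] with x hx hx'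
    rw [weight_one, weight_one, hx, hx']
  have hf : flux 1 q ω =ᶠ[𝓝 σ] flux 1 q ω' := by
    filter_upwards [hw, he.deriv] with x hx hx'
    rw [flux, flux, hx, hx']
  obtain ⟨h1, h2⟩ := h
  refine ⟨h1.congr_of_eventuallyEq hf.symm, ?_⟩
  rw [← hf.deriv_eq, ← hw.eq_of_nhds, ← he.eq_of_nhds]
  exact h2

/-- A global periodic profile gives a positive solution. -/
lemma rpow_mem_positiveSolutions (hq : 0 < q) (h : ∀ σ, IsProfileAt c w S σ)
    (hp : Function.Periodic w (2 * π)) :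
    (fun x => w x ^ (1 / q)) ∈ positiveSolutions 1 q c := by
  have hpos : ∀ σ, 0 < w σ ^ (1 / q) := fun σ => rpow_pos_of_pos (h σ).pos _
  refine ⟨⟨?_, fun σ => by simp only [hp σ], fun σ _ => ?_⟩, fun σ => (hpos σ).le, ?_⟩
  · rw [contDiff_one_iff_deriv]
    refine ⟨fun σ => ((h σ).hasDerivAt_rpow hq).differentiableAt, ?_⟩
    have hS : Continuous S := continuous_iff_continuousAt.2 fun σ => (h σ).deriv_S.continuousAt
    have hw : Continuous fun x => w x ^ (1 / q) :=
      continuous_iff_continuousAt.2 fun σ => ((h σ).hasDerivAt_rpow hq).continuousAt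
    have : deriv (fun x => w x ^ (1 / q)) =
        fun σ => 1 / q * w σ ^ (1 / q) * S σ / √(1 - S σ ^ 2) :=
      funext fun σ => ((h σ).hasDerivAt_rpow hq).deriv
    rw [this]
    exact ((continuous_const.mul hw).mul hS).div (by fun_prop) fun σ => (h σ).sqrt_pos.ne'
  · exact equationAt_of_isProfileAt hq (Eventually.of_forall h)
  · have : {σ | 0 < w σ ^ (1 / q)} = univ := eq_univ_of_forall hpos
    rw [this]
    exact dense_univ

lemma IsProfileAt.hasDerivAt_sqrt (h : IsProfileAt c w S σ) :
    HasDerivAt (fun x => √(1 - S x ^ 2))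
      (-(S σ * (√(1 - S σ ^ 2) - w σ + c)) / √(1 - S σ ^ 2)) σ := by
  have h1 := ((h.deriv_S.pow 2).const_sub 1).sqrt (by linarith [h.sq_lt] : 1 - S σ ^ 2 ≠ 0)
  refine h1.congr_deriv ?_
  have := h.sqrt_pos.ne'
  simp only [Pi.pow_apply, Nat.cast_ofNat, Nat.add_one_sub_one, pow_one]
  field_simp

/-- Conservation of energy. -/
lemma IsProfileAt.hasDerivAt_energy (h : IsProfileAt c w S σ) :
    HasDerivAt (fun x => w x * (√(1 - S x ^ 2) + c - w x / 2)) 0 σ := by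
  have h1 := h.deriv_w.mul ((h.hasDerivAt_sqrt.add_const c).sub (h.deriv_w.div_const 2))
  refine h1.congr_deriv ?_
  have := h.sqrt_pos.ne'
  change w σ * S σ / √(1 - S σ ^ 2) * (√(1 - S σ ^ 2) + c - w σ / 2) + _ = 0
  field_simp
  ring

end Conversion

/-! ### Positivity intervals bounded by zeros -/

/-- A maximal interval of positivity. -/
lemma exists_pos_component {f : ℝ → ℝ} (hf : Continuous f) {σ z₁ z₂ : ℝ} (hσ : 0 < f σ)
    (h₁ : z₁ < σ) (hz₁ : f z₁ = 0) (h₂ : σ < z₂) (hz₂ : f z₂ = 0) :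
    ∃ a b, z₁ ≤ a ∧ a < σ ∧ σ < b ∧ b ≤ z₂ ∧ f a = 0 ∧ f b = 0 ∧ ∀ x ∈ Ioo a b, 0 < f x := by
  have hcl : IsClosed {x | f x = 0} := isClosed_eq hf continuous_const
  set A := {x | f x = 0} ∩ Iic σ with hA
  set B := {x | f x = 0} ∩ Ici σ with hB
  have hAc : IsClosed A := hcl.inter isClosed_Iic
  have hBc : IsClosed B := hcl.inter isClosed_Ici
  have hAb : BddAbove A := ⟨σ, fun x hx => hx.2⟩
  have hBb : BddBelow B := ⟨σ, fun x hx => hx.2⟩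
  have hzA : z₁ ∈ A := ⟨hz₁, h₁.le⟩
  have hzB : z₂ ∈ B := ⟨hz₂, h₂.le⟩
  have ha := hAc.csSup_mem ⟨_, hzA⟩ hAb
  have hb := hBc.csInf_mem ⟨_, hzB⟩ hBb
  have hane : sSup A ≠ σ := fun h => by
    have := ha.1
    rw [mem_ofPred_eq, h] at this
    exact hσ.ne' this
  have hbne : sInf B ≠ σ := fun h => by
    have := hb.1
    rw [mem_ofPred_eq, h] at this
    exact hσ.ne' this
  refine ⟨sSup A, sInf B, le_csSup hAb hzA, lt_of_le_of_ne ha.2 hane,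
    lt_of_le_of_ne hb.2 hbne.symm, csInf_le hBb hzB, ha.1, hb.1, fun x hx => ?_⟩
  by_contra! hneg
  rcases le_total x σ with hxσ | hxσ
  · obtain ⟨y, hy, hy0⟩ := intermediate_value_Icc hxσ hf.continuousOn ⟨hneg, hσ.le⟩
    exact absurd (le_csSup hAb ⟨hy0, hy.2⟩) (not_le.2 (hx.1.trans_le hy.1))
  · obtain ⟨y, hy, hy0⟩ := intermediate_value_Icc' hxσ hf.continuousOn ⟨hneg, hσ.le⟩
    exact absurd (csInf_le hBb ⟨hy0, hy.1⟩) (not_le.2 (hy.2.trans_lt hx.2))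

lemma exists_pos_component_of_periodic {f : ℝ → ℝ} (hf : Continuous f)
    (hp : Function.Periodic f (2 * π)) {σ z : ℝ} (hσ : 0 < f σ) (hz : f z = 0) :
    ∃ a b, a < σ ∧ σ < b ∧ f a = 0 ∧ f b = 0 ∧ ∀ x ∈ Ioo a b, 0 < f x := by
  -- The translate `y` of the zero in `[σ, σ + 2π)` and `y - 2π` enclose `σ`.
  obtain ⟨y, hy, hyz⟩ := hp.exists_mem_Ico two_pi_pos z σ
  have hyσ : σ ≠ y := fun h => by rw [← h, hz] at hyz; exact hσ.ne hyz
  obtain ⟨a, b, -, h1, h2, -, h3⟩ := exists_pos_component hf hσ (z₁ := y - 2 * π) (z₂ := y)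
    (by linarith [hy.2]) (by rw [hp.sub_eq, ← hyz, hz]) (lt_of_le_of_ne hy.1 hyσ)
    (by rw [← hyz, hz])
  exact ⟨a, b, h1, h2, h3⟩

/-! ### Zero energy and the shape of a positivity interval -/

section Component

variable {c a b : ℝ} {w S : ℝ → ℝ}

/-- On an interval at the left end of which `w` vanishes, the energy is zero. -/
lemma energy_eq_zero (h : ∀ x ∈ Ioo a b, IsProfileAt c w S x) (hw : ContinuousAt w a)
    (ha : w a = 0) {x : ℝ} (hx : x ∈ Ioo a b) : √(1 - S x ^ 2) + c = w x / 2 := by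
  set H := fun x => w x * (√(1 - S x ^ 2) + c - w x / 2) with hH
  have hconst : ∀ y ∈ Ioo a b, H y = H x := fun y hy =>
    isOpen_Ioo.is_const_of_deriv_eq_zero isPreconnected_Ioo
      (fun z hz => (h z hz).hasDerivAt_energy.differentiableAt.differentiableWithinAt)
      (fun z hz => (h z hz).hasDerivAt_energy.deriv) hy hx
  have hab : a < b := hx.1.trans hx.2
  have hlim : Tendsto H (𝓝[>] a) (𝓝 0) := by
    have hw0 : Tendsto w (𝓝[>] a) (𝓝 0) := by
      have := hw.tendsto.mono_left (nhdsWithin_le_nhds (s := Ioi a))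
      rwa [ha] at this
    have hb : Tendsto (fun y => w y * (1 + |c| + w y / 2)) (𝓝[>] a) (𝓝 0) := by
      have := hw0.mul ((tendsto_const_nhds (x := 1 + |c|)).add (hw0.div_const 2))
      simpa using this
    refine squeeze_zero_norm' ?_ hb
    filter_upwards [Ioo_mem_nhdsGT hab] with y hy
    have hy' := h y hy
    have := hy'.sqrt_le_one
    have := hy'.sqrt_pos
    have := hy'.pos
    rw [hH, norm_eq_abs, abs_mul, abs_of_pos hy'.pos]
    gcongr
    rw [abs_le]
    constructor <;> linarith [neg_abs_le c, le_abs_self c]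
  have hlim' : Tendsto H (𝓝[>] a) (𝓝 (H x)) := by
    refine tendsto_const_nhds.congr' ?_
    filter_upwards [Ioo_mem_nhdsGT hab] with y hy using (hconst y hy).symm
  have h0 : H x = 0 := tendsto_nhds_unique hlim' hlim
  have hx' := (h x hx).pos.ne'
  have := (mul_eq_zero.1 h0).resolve_left hx'
  linarith

/-- If `w` vanishes at both ends of an interval, then `c = 0`, the interval has length `π` and `w`
is explicit. -/
lemma component_eq (hab : a < b) (h : ∀ x ∈ Ioo a b, IsProfileAt c w S x) (hw : Continuous w)
    (ha : w a = 0) (hb : w b = 0) :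
    c = 0 ∧ b = a + π ∧ ∀ x ∈ Ioo a b, w x = 2 * sin (x - a) := by
  have hE : ∀ x ∈ Ioo a b, √(1 - S x ^ 2) + c = w x / 2 := fun x hx =>
    energy_eq_zero h hw.continuousAt ha hx
  have hne : (𝓝[>] a).NeBot := inferInstance
  have hc : c = 0 := by
    rcases lt_trichotomy c 0 with hc | hc | hc
    · exfalso
      obtain ⟨x₀, hx₀⟩ := nonempty_Ioo.2 hab
      -- Zero energy gives `√(1 - S²) > -c`, so `w' / w ≥ -L` and `w exp (L x)` is nondecreasing. A
      -- positive nondecreasing function cannot tend to `0` at `b`.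
      set L := (-c)⁻¹ with hL
      set g := fun x => w x * exp (L * x) with hg
      have hgd : ∀ x ∈ Ioo a b, HasDerivAt g
          ((w x * S x / √(1 - S x ^ 2)) * exp (L * x) + w x * (exp (L * x) * L)) x := by
        intro x hx
        have h2 : HasDerivAt (fun x => exp (L * x)) (exp (L * x) * L) x := by
          simpa using ((hasDerivAt_id x).const_mul L).exp
        exact (h x hx).deriv_w.mul h2
      have hmono : MonotoneOn g (Ioo a b) := by
        refine monotoneOn_of_deriv_nonneg (convex_Ioo a b)
          (fun x hx => (hgd x hx).continuousAt.continuousWithinAt)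
          (fun x hx => ?_) (fun x hx => ?_)
        · rw [interior_Ioo] at hx
          exact (hgd x hx).differentiableAt.differentiableWithinAt
        · rw [interior_Ioo] at hx
          rw [(hgd x hx).deriv]
          have hx' := h x hx
          have hC := hx'.sqrt_pos
          have hCc : -c < √(1 - S x ^ 2) := by linarith [hE x hx, hx'.pos]
          have hS : -1 ≤ S x := by nlinarith [hx'.sq_lt]
          have h3 : (√(1 - S x ^ 2))⁻¹ ≤ L := inv_anti₀ (by linarith) hCc.le
          have h3' := inv_pos.2 hC
          have h4 : 0 ≤ S x * (√(1 - S x ^ 2))⁻¹ + L := by nlinarith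
          have h5 := mul_nonneg (mul_nonneg hx'.pos.le (exp_pos (L * x)).le) h4
          rw [div_eq_mul_inv]
          linarith
      have hlim : Tendsto g (𝓝[<] b) (𝓝 0) := by
        have : Continuous g := by fun_prop
        have := this.continuousAt.tendsto.mono_left (nhdsWithin_le_nhds (a := b) (s := Iio b))
        simpa [hg, hb] using this
      have : g x₀ ≤ 0 := by
        refine ge_of_tendsto hlim ?_
        filter_upwards [Ioo_mem_nhdsLT hx₀.2] with y hy
        exact hmono hx₀ ⟨hx₀.1.trans hy.1, hy.2⟩ hy.1.le
      exact absurd (mul_pos (h x₀ hx₀).pos (exp_pos (L * x₀))) (not_lt.2 this)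
    · exact hc
    · exfalso
      have hlim : Tendsto w (𝓝[>] a) (𝓝 0) := by
        have := hw.continuousAt.tendsto.mono_left (nhdsWithin_le_nhds (a := a) (s := Ioi a))
        rwa [ha] at this
      have : 2 * c ≤ 0 := by
        refine ge_of_tendsto hlim ?_
        filter_upwards [Ioo_mem_nhdsGT hab] with y hy
        linarith [hE y hy, (h y hy).sqrt_pos]
      linarith
  subst hc
  have hE' : ∀ x ∈ Ioo a b, w x = 2 * √(1 - S x ^ 2) := fun x hx => by linarith [hE x hx]
  -- With `c = 0` and `w = 2 √(1 - S²)` the second equation is `S' = -√(1 - S²)`, so `arcsin S` has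
  -- slope `-1`.
  have hd : ∀ x ∈ Ioo a b, HasDerivAt (fun x => arcsin (S x) + x) 0 x := by
    intro x hx
    have hx' := h x hx
    have h1 : S x ≠ -1 := fun h => by have := hx'.sq_lt; rw [h] at this; norm_num at this
    have h2 : S x ≠ 1 := fun h => by have := hx'.sq_lt; rw [h] at this; norm_num at this
    have := ((hasDerivAt_arcsin h1 h2).comp x hx'.deriv_S).add (hasDerivAt_id x)
    refine this.congr_deriv ?_
    rw [hE' x hx]
    have := hx'.sqrt_pos.ne'
    field_simp
    ring
  obtain ⟨x₀, hx₀⟩ := nonempty_Ioo.2 hab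
  obtain ⟨k, hk⟩ : ∃ k, ∀ x ∈ Ioo a b, arcsin (S x) = k - x := by
    refine ⟨arcsin (S x₀) + x₀, fun x hx => ?_⟩
    have := isOpen_Ioo.is_const_of_deriv_eq_zero isPreconnected_Ioo
      (fun z hz => (hd z hz).differentiableAt.differentiableWithinAt)
      (fun z hz => (hd z hz).deriv) hx hx₀
    linarith
  have hwk : ∀ x ∈ Ioo a b, w x = 2 * cos (k - x) := by
    intro x hx
    rw [hE' x hx, ← cos_arcsin, hk x hx]
  -- The formula and the range of `k - x` pass to the closed interval by continuity. The cosine then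
  -- vanishes at both ends, which must be `π / 2` and `-π / 2`, in this order since `a < b`.
  have hwk' : EqOn w (fun x => 2 * cos (k - x)) (Icc a b) := by
    rw [← closure_Ioo hab.ne]
    exact EqOn.closure hwk hw (by fun_prop)
  have hkb : ∀ x ∈ Icc a b, k - x ∈ Icc (-(π / 2)) (π / 2) := by
    rw [← closure_Ioo hab.ne]
    intro x hx
    have : IsClosed {x : ℝ | k - x ∈ Icc (-(π / 2)) (π / 2)} :=
      isClosed_Icc.preimage (by fun_prop)
    refine closure_minimal (fun y hy => ?_) this hx
    rw [mem_ofPred_eq, ← hk y hy]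
    exact arcsin_mem_Icc _
  have key : ∀ t, t ∈ Icc (-(π / 2)) (π / 2) → cos t = 0 → t = -(π / 2) ∨ t = π / 2 := by
    intro t ht h0
    by_contra! hcon
    exact (cos_pos_of_mem_Ioo ⟨lt_of_le_of_ne ht.1 hcon.1.symm, lt_of_le_of_ne ht.2 hcon.2⟩).ne' h0
  have hma := left_mem_Icc.2 hab.le
  have hmb := right_mem_Icc.2 hab.le
  have ha' := key _ (hkb a hma) (by have := hwk' hma; simp only at this; linarith)
  have hb' := key _ (hkb b hmb) (by have := hwk' hmb; simp only at this; linarith)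
  have ha'' : k - a = π / 2 := by
    rcases ha' with h1 | h1
    · linarith [(hkb b hmb).1]
    · exact h1
  have hb'' : k - b = -(π / 2) := by
    rcases hb' with h1 | h1
    · exact h1
    · linarith [(hkb a hma).2]
  refine ⟨rfl, by linarith, fun x hx => ?_⟩
  rw [hwk x hx, show k - x = π / 2 - (x - a) by linarith, cos_pi_div_two_sub]

end Component

/-- A solution with a zero and a positive value forces `c = 0` and is explicit near that value. -/
lemma IsSolution.component {q c : ℝ} {ω : ℝ → ℝ} (hq : 0 < q) (h : IsSolution 1 q c ω)
    {σ z : ℝ} (hσ : 0 < ω σ) (hz : ω z = 0) :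
    c = 0 ∧ ∃ a, σ ∈ Ioo a (a + π) ∧ ω a = 0 ∧ ω (a + π) = 0 ∧
      ∀ x ∈ Ioo a (a + π), 0 < ω x ∧ ω x ^ q = 2 * sin (x - a) := by
  have hc : Continuous ω := h.contDiff.continuous
  obtain ⟨a, b, ha, hb, ha0, hb0, hpos⟩ :=
    exists_pos_component_of_periodic hc h.periodic hσ hz
  obtain ⟨h1, h2, h3⟩ := component_eq (ha.trans hb)
    (fun x hx => h.isProfileAt hq (hpos x hx)) (hc.rpow_const fun _ => Or.inr hq.le)
    (by rw [ha0, zero_rpow hq.ne']) (by rw [hb0, zero_rpow hq.ne'])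
  subst h2
  exact ⟨h1, a, ⟨ha, hb⟩, ha0, hb0, fun x hx => ⟨hpos x hx, h3 x hx⟩⟩

/-! ### Regularity of `|x| ^ r * x` -/

section AbsRpowMul

lemma hasDerivAt_abs_rpow_mul_self {r : ℝ} (hr : 0 < r) (x : ℝ) :
    HasDerivAt (fun x : ℝ => |x| ^ r * x) ((r + 1) * |x| ^ r) x := by
  rcases eq_or_ne x 0 with rfl | hx
  · rw [hasDerivAt_iff_tendsto_slope]
    have h1 : Tendsto (fun x : ℝ => |x| ^ r) (𝓝[≠] 0) (𝓝 ((r + 1) * |0| ^ r)) := by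
      have : Continuous fun x : ℝ => |x| ^ r :=
        continuous_abs.rpow_const fun _ => Or.inr hr.le
      have := this.continuousAt.tendsto.mono_left (nhdsWithin_le_nhds (a := (0 : ℝ)) (s := {0}ᶜ))
      simpa [zero_rpow hr.ne'] using this
    refine h1.congr' ?_
    filter_upwards [self_mem_nhdsWithin] with y hy
    have : y ≠ 0 := hy
    simp [slope_def_field, this]
  · have h1 := ((hasDerivAt_abs hx).rpow_const (p := r) (Or.inl (abs_ne_zero.2 hx))).mul
      (hasDerivAt_id x)
    refine h1.congr_deriv ?_
    rw [rpow_sub_one (abs_ne_zero.2 hx)]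
    have h2 : (SignType.sign x : ℝ) * x = |x| := sign_mul_self x
    have h3 := abs_ne_zero.2 hx
    simp only [id]
    field_simp
    linear_combination r * h2

lemma contDiff_abs_rpow_mul_self {r : ℝ} (hr : 0 ≤ r) :
    ContDiff ℝ 1 (fun x : ℝ => |x| ^ r * x) := by
  rcases hr.eq_or_lt with rfl | hr
  · simpa using contDiff_fun_id
  · rw [contDiff_one_iff_deriv]
    refine ⟨fun x => (hasDerivAt_abs_rpow_mul_self hr x).differentiableAt, ?_⟩
    rw [funext fun x => (hasDerivAt_abs_rpow_mul_self hr x).deriv]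
    exact continuous_const.mul (continuous_abs.rpow_const fun _ => Or.inr hr.le)

end AbsRpowMul

/-! ### The explicit solutions with zeros, for `c = 0` -/

section Explicit

variable {q : ℝ}

lemma isProfileAt_sin {σ : ℝ} (h : 0 < sin σ) :
    IsProfileAt 0 (fun x => 2 * sin x) cos σ := by
  have h1 : 1 - cos σ ^ 2 = sin σ ^ 2 := by linarith [sin_sq_add_cos_sq σ]
  have h2 : √(1 - cos σ ^ 2) = sin σ := by rw [h1, sqrt_sq h.le]
  refine ⟨by positivity, by nlinarith, ?_, ?_⟩
  · refine ((hasDerivAt_sin σ).const_mul 2).congr_deriv ?_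
    rw [h2]
    field_simp
  · refine (hasDerivAt_cos σ).congr_deriv ?_
    rw [h2]
    ring

lemma equationAt_sin_rpow (hq : 0 < q) {σ : ℝ} (h : 0 < sin σ) :
    EquationAt 1 q 0 (fun x => (2 * sin x) ^ (1 / q)) σ := by
  refine equationAt_of_isProfileAt hq (S := cos) ?_
  filter_upwards [continuous_sin.continuousAt.eventually (lt_mem_nhds h)] with x hx
    using isProfileAt_sin hx

lemma omegaZeroPos_eq_of_pos {σ : ℝ} (h : 0 < sin σ) :
    omegaZeroPos q σ = (2 * sin σ) ^ (1 / q) := by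
  rw [omegaZeroPos, abs_of_pos h]

lemma omegaZero_eq_of_pos (hq : 0 < q) {σ : ℝ} (h : 0 < sin σ) :
    omegaZero q σ = (2 * sin σ) ^ (1 / q) := by
  have h1 : (1 - q) / q = 1 / q - 1 := by field_simp
  rw [omegaZero, abs_of_pos h, mul_assoc, h1, rpow_sub_one h.ne', div_mul_cancel₀ _ h.ne',
    mul_rpow zero_le_two h.le]

lemma omegaZero_add_pi (σ : ℝ) : omegaZero q (σ + π) = -omegaZero q σ := by
  simp [omegaZero, sin_add_pi]

lemma omegaZeroPos_add_pi (σ : ℝ) : omegaZeroPos q (σ + π) = omegaZeroPos q σ := by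
  simp [omegaZeroPos, sin_add_pi]

lemma omegaZero_periodic : Function.Periodic (omegaZero q) (2 * π) := fun σ => by
  rw [show σ + 2 * π = σ + π + π by ring, omegaZero_add_pi, omegaZero_add_pi, neg_neg]

lemma omegaZeroPos_periodic : Function.Periodic (omegaZeroPos q) (2 * π) := fun σ => by
  rw [show σ + 2 * π = σ + π + π by ring, omegaZeroPos_add_pi, omegaZeroPos_add_pi]

lemma equationAt_omegaZero_of_pos (hq : 0 < q) {σ : ℝ} (h : 0 < sin σ) :
    EquationAt 1 q 0 (omegaZero q) σ := by
  refine (equationAt_sin_rpow hq h).congr ?_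
  filter_upwards [continuous_sin.continuousAt.eventually (lt_mem_nhds h)] with x hx
    using (omegaZero_eq_of_pos hq hx).symm

lemma equationAt_omegaZeroPos_of_pos (hq : 0 < q) {σ : ℝ} (h : 0 < sin σ) :
    EquationAt 1 q 0 (omegaZeroPos q) σ := by
  refine (equationAt_sin_rpow hq h).congr ?_
  filter_upwards [continuous_sin.continuousAt.eventually (lt_mem_nhds h)] with x hx
    using (omegaZeroPos_eq_of_pos hx).symm

lemma equationAt_omegaZero (hq : 0 < q) {σ : ℝ} (h : sin σ ≠ 0) :
    EquationAt 1 q 0 (omegaZero q) σ := by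
  rcases h.lt_or_gt with h | h
  · have h1 := (equationAt_omegaZero_of_pos hq (σ := σ + π) (by rw [sin_add_pi]; linarith)).shift
    rw [funext fun x => omegaZero_add_pi x] at h1
    have h2 := h1.neg
    have : (-fun x => -omegaZero q x) = omegaZero q := by funext x; simp
    rwa [this] at h2
  · exact equationAt_omegaZero_of_pos hq h

lemma equationAt_omegaZeroPos (hq : 0 < q) {σ : ℝ} (h : sin σ ≠ 0) :
    EquationAt 1 q 0 (omegaZeroPos q) σ := by
  rcases h.lt_or_gt with h | h
  · have h1 :=
      (equationAt_omegaZeroPos_of_pos hq (σ := σ + π) (by rw [sin_add_pi]; linarith)).shift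
    rwa [funext fun x => omegaZeroPos_add_pi x] at h1
  · exact equationAt_omegaZeroPos_of_pos hq h

lemma contDiff_omegaZero (hq : 0 < q) (hq1 : q ≤ 1) : ContDiff ℝ 1 (omegaZero q) := by
  have h1 : 0 ≤ (1 - q) / q := div_nonneg (by linarith) hq.le
  have h2 : omegaZero q = fun σ => (2 : ℝ) ^ (1 / q) * (|sin σ| ^ ((1 - q) / q) * sin σ) := by
    funext σ; rw [omegaZero, mul_assoc]
  rw [h2]
  exact contDiff_const.mul ((contDiff_abs_rpow_mul_self h1).comp contDiff_sin)

lemma isSolution_omegaZero (hq : 0 < q) (hq1 : q ≤ 1) : IsSolution 1 q 0 (omegaZero q) where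
  contDiff := contDiff_omegaZero hq hq1
  periodic := omegaZero_periodic
  equation σ hσ := by
    by_cases hs : sin σ = 0
    · have h0 : omegaZero q σ = 0 := by simp [omegaZero, hs]
      have hd : deriv (omegaZero q) σ ≠ 0 := by simpa [Meaningful, h0] using hσ
      -- For `q = 1` the function is `2 sin`, whose flux is `cos`, and the equation holds even at
      -- the zeros. For `q < 1` the derivative vanishes at the zeros, where nothing is required.
      rcases hq1.eq_or_lt with rfl | hlt
      · have hω : omegaZero 1 = fun x => 2 * sin x := by funext x; simp [omegaZero]
        have hdω : ∀ x, deriv (omegaZero 1) x = 2 * cos x := fun x => by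
          rw [hω]; exact ((hasDerivAt_sin x).const_mul 2).deriv
        have hw : ∀ x, weight 1 1 (omegaZero 1) x = 2⁻¹ := fun x => by
          rw [weight_one, hdω, hω]
          have : ((1 : ℝ) / 1) ^ 2 * (2 * sin x) ^ 2 + (2 * cos x) ^ 2 = 2 ^ 2 := by
            nlinarith [sin_sq_add_cos_sq x]
          rw [this, sqrt_sq zero_le_two]
        have hf : flux 1 1 (omegaZero 1) = cos := by
          funext x
          rw [flux, hw, hdω]; ring
        refine ⟨by rw [hf]; exact differentiable_cos σ, ?_⟩
        rw [hf, h0, Real.deriv_cos, hs]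
        simp
      · exfalso
        apply hd
        have hr : 0 < (1 - q) / q := div_pos (by linarith) hq
        have h2 : omegaZero q = fun σ => (2 : ℝ) ^ (1 / q) * (|sin σ| ^ ((1 - q) / q) * sin σ) := by
          funext σ; rw [omegaZero, mul_assoc]
        have h1 := ((hasDerivAt_abs_rpow_mul_self hr (sin σ)).comp σ (hasDerivAt_sin σ)).const_mul
          ((2 : ℝ) ^ (1 / q))
        rw [h2]
        refine h1.deriv.trans ?_
        simp [hs, zero_rpow hr.ne']
    · exact equationAt_omegaZero hq hs

lemma omegaZero_mem (hq : 0 < q) (hq1 : q ≤ 1) :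
    omegaZero q ∈ signChangingSolutions 1 q 0 := by
  have hpos : 0 < omegaZero q (π / 2) := by
    rw [omegaZero_eq_of_pos hq (by simp)]
    exact rpow_pos_of_pos (by simp) _
  exact ⟨isSolution_omegaZero hq hq1, ⟨π / 2, hpos⟩, ⟨π / 2 + π, by
    rw [omegaZero_add_pi]; linarith⟩⟩

lemma omegaZeroPos_nonneg (σ : ℝ) : 0 ≤ omegaZeroPos q σ := by
  unfold omegaZeroPos; positivity

lemma deriv_eq_zero_of_nonneg {f : ℝ → ℝ} (hf : ∀ x, 0 ≤ f x) {a : ℝ} (ha : f a = 0) :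
    deriv f a = 0 :=
  IsLocalMin.deriv_eq_zero (Eventually.of_forall fun x => by rw [ha]; exact hf x)

lemma omegaZeroPos_mem (hq : 0 < q) (hq1 : q < 1) : omegaZeroPos q ∈ positiveSolutions 1 q 0 := by
  refine ⟨⟨?_, omegaZeroPos_periodic, fun σ hσ => ?_⟩, omegaZeroPos_nonneg, ?_⟩
  · have h1 : omegaZeroPos q = (fun x : ℝ => ‖x‖ ^ (1 / q)) ∘ fun σ => 2 * sin σ := by
      funext σ; simp [omegaZeroPos, abs_mul]
    rw [h1]
    exact (contDiff_norm_rpow (by rw [lt_div_iff₀ hq]; linarith)).comp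
      (contDiff_const.mul contDiff_sin)
  · by_cases hs : sin σ = 0
    · have h0 : omegaZeroPos q σ = 0 := by
        simp [omegaZeroPos, hs, hq.ne']
      have hd := deriv_eq_zero_of_nonneg omegaZeroPos_nonneg h0
      simp [Meaningful, h0, hd] at hσ
    · exact equationAt_omegaZeroPos hq hs
  -- The zeros are the multiples of `π`, a countable set, so their complement is dense.
  · have h1 : {σ | 0 < omegaZeroPos q σ} = (range fun n : ℤ => (n : ℝ) * π)ᶜ := by
      ext σ
      rw [mem_compl_iff, mem_range, ← sin_eq_zero_iff, mem_ofPred_eq]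
      constructor
      · intro h h0
        simp [omegaZeroPos, h0, hq.ne'] at h
      · intro h
        exact rpow_pos_of_pos (by positivity) _
    rw [h1]
    exact (countable_range _).dense_compl ℝ

end Explicit

/-! ### Classification of solutions with zeros -/

section Classification

variable {q : ℝ} {ω : ℝ → ℝ}

/-- The right derivative of `g` at `a` would have to be `2`. Applied to `ω` or `|ω| ^ q`, this is
what restricts `q`. -/
lemma not_hasDerivAt_zero_of_eq_sin {g : ℝ → ℝ} {a : ℝ} (ha : g a = 0)
    (h : ∀ x ∈ Ioo a (a + π), g x = 2 * sin (x - a)) : ¬ HasDerivAt g 0 a := by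
  intro hg
  have h1 : HasDerivAt (fun x => 2 * sin (x - a)) 2 a := by
    have := ((hasDerivAt_sin (a - a)).comp_sub_const a a).const_mul 2
    simpa using this
  have h2 : HasDerivWithinAt g 2 (Ioi a) a := by
    refine h1.hasDerivWithinAt.congr_of_eventuallyEq ?_ (by simp [ha])
    filter_upwards [Ioo_mem_nhdsGT (show a < a + π by linarith [pi_pos])] with x hx using h x hx
  have := (uniqueDiffWithinAt_Ioi a).eq_deriv _ hg.hasDerivWithinAt h2
  norm_num at this

/-- An interval of length `π` without zeros of `f` that meets the interval between the zeros `b` and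
`b + π` is equal to it. -/
lemma component_left_eq {f : ℝ → ℝ} {b a σ : ℝ} (hb : f b = 0) (hb' : f (b + π) = 0)
    (hσ : σ ∈ Ioo b (b + π)) (hσ' : σ ∈ Ioo a (a + π)) (h : ∀ x ∈ Ioo a (a + π), f x ≠ 0) :
    a = b := by
  apply le_antisymm
  · by_contra! hlt
    exact h (b + π) ⟨by linarith [hσ.2, hσ'.1], by linarith⟩ hb'
  · by_contra! hlt
    exact h b ⟨hlt, by linarith [hσ.1, hσ'.2]⟩ hb

lemma eq_of_periodic_of_eqOn {f g : ℝ → ℝ} (hf : Function.Periodic f (2 * π))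
    (hg : Function.Periodic g (2 * π)) {a : ℝ} (h : ∀ x ∈ Ico a (a + 2 * π), f x = g x) :
    f = g := by
  funext x
  have hp : Function.Periodic (fun x => f x - g x) (2 * π) := fun x => by simp [hf x, hg x]
  obtain ⟨y, hy, hxy⟩ := hp.exists_mem_Ico two_pi_pos x a
  simp only [h y hy, sub_self] at hxy
  linarith

/-- Four cases for the position of a point in a period. -/
lemma cases_Ico {a x : ℝ} (hx : x ∈ Ico a (a + 2 * π)) :
    x = a ∨ x ∈ Ioo a (a + π) ∨ x = a + π ∨ x ∈ Ioo (a + π) (a + π + π) := by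
  rcases hx.1.eq_or_lt with h | h
  · exact Or.inl h.symm
  rcases lt_trichotomy x (a + π) with h1 | h1 | h1
  · exact Or.inr (Or.inl ⟨h, h1⟩)
  · exact Or.inr (Or.inr (Or.inl h1))
  · exact Or.inr (Or.inr (Or.inr ⟨h1, by linarith [hx.2]⟩))

lemma eq_rpow_of_rpow_eq (hq : 0 < q) {x y : ℝ} (hx : 0 ≤ x) (h : x ^ q = y) :
    x = y ^ (1 / q) := by
  rw [← h, ← rpow_mul hx, mul_one_div_cancel hq.ne', rpow_one]

lemma sin_sub_pos {a x : ℝ} (hx : x ∈ Ioo a (a + π)) : 0 < sin (x - a) :=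
  sin_pos_of_pos_of_lt_pi (by linarith [hx.1]) (by linarith [hx.2])

/-- Nonnegative solutions with a zero. -/
lemma positive_with_zero {c : ℝ} (hq : 0 < q) (h : ω ∈ positiveSolutions 1 q c) {z : ℝ}
    (hz : ω z = 0) : c = 0 ∧ q < 1 ∧ ω ∈ rotations (omegaZeroPos q) := by
  obtain ⟨hs, hnn, hdense⟩ := h
  obtain ⟨σ, hσ⟩ := hdense.nonempty
  obtain ⟨hc, a, -, ha, ha', hpos⟩ := hs.component hq hσ hz
  refine ⟨hc, ?_, ?_⟩
  · by_contra! hq1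
    have hd : HasDerivAt ω (deriv ω a) a := (hs.contDiff.differentiable one_ne_zero a).hasDerivAt
    rcases hq1.eq_or_lt with rfl | hlt
    · rw [deriv_eq_zero_of_nonneg hnn ha] at hd
      exact not_hasDerivAt_zero_of_eq_sin ha
        (fun x hx => by simpa using (hpos x hx).2) hd
    · have h1 := (hasDerivAt_abs_rpow (ω a) hlt).comp a hd
      simp only [ha, mul_zero, zero_mul] at h1
      refine not_hasDerivAt_zero_of_eq_sin ?_ (fun x hx => ?_) h1
      · simp [ha, hq.ne']
      · simp only [Function.comp, abs_of_pos (hpos x hx).1]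
        exact (hpos x hx).2
  · have ha2 : ω (a + π + π) = 0 := by
      rw [show a + π + π = a + 2 * π by ring, hs.periodic, ha]
    -- Density excludes that `ω` vanishes on the second half period; a positivity interval there has
    -- length `π` and so fills it.
    obtain ⟨σ₂, hσ₂, hm⟩ := hdense.exists_mem_open (isOpen_Ioo (a := a + π) (b := a + π + π))
      (nonempty_Ioo.2 (by linarith [pi_pos]))
    obtain ⟨-, b, hb, -, -, hposb⟩ := hs.component hq hσ₂ hz
    have hab : b = a + π :=
      component_left_eq ha' ha2 hm hb fun x hx => (hposb x hx).1.ne'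
    subst hab
    refine ⟨-a, ?_⟩
    refine (eq_of_periodic_of_eqOn hs.periodic ?_ (a := a) fun x hx => ?_).symm
    · intro x
      have := omegaZeroPos_periodic (q := q) (x + -a)
      simpa [add_right_comm] using this
    · simp only [← sub_eq_add_neg]
      rcases cases_Ico hx with h | h | h | h
      · simp [h, ha, omegaZeroPos, hq.ne']
      · rw [omegaZeroPos_eq_of_pos (sin_sub_pos h)]
        exact eq_rpow_of_rpow_eq hq (hpos x h).1.le (hpos x h).2
      · simp [h, ha', omegaZeroPos, hq.ne']
      · rw [← omegaZeroPos_add_pi, ← omegaZeroPos_periodic.sub_eq,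
          show x - a + π - 2 * π = x - (a + π) by ring, omegaZeroPos_eq_of_pos (sin_sub_pos h)]
        exact eq_rpow_of_rpow_eq hq (hposb x h).1.le (hposb x h).2

/-- Sign changing solutions. -/
lemma signChanging_classification {c : ℝ} (hq : 0 < q) (h : ω ∈ signChangingSolutions 1 q c) :
    c = 0 ∧ q ≤ 1 ∧ ω ∈ rotations (omegaZero q) := by
  obtain ⟨hs, ⟨σ, hσ⟩, ⟨σ', hσ'⟩⟩ := h
  obtain ⟨z, hz⟩ : ∃ z, ω z = 0 := by
    have := mem_range_of_exists_le_of_exists_ge hs.contDiff.continuous ⟨σ', hσ'.le⟩ ⟨σ, hσ.le⟩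
    exact this
  obtain ⟨hc, a, -, ha, ha', hpos⟩ := hs.component hq hσ hz
  refine ⟨hc, ?_, ?_⟩
  · by_contra! hlt
    have hd : HasDerivAt ω (deriv ω a) a := (hs.contDiff.differentiable one_ne_zero a).hasDerivAt
    have h1 := (hasDerivAt_abs_rpow (ω a) hlt).comp a hd
    simp only [ha, mul_zero, zero_mul] at h1
    refine not_hasDerivAt_zero_of_eq_sin ?_ (fun x hx => ?_) h1
    · simp [ha, hq.ne']
    · simp only [Function.comp, abs_of_pos (hpos x hx).1]
      exact (hpos x hx).2
  · have ha2 : ω (a + π + π) = 0 := by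
      rw [show a + π + π = a + 2 * π by ring, hs.periodic, ha]
    obtain ⟨σ₂, hm, hσ₂⟩ := hs.periodic.exists_mem_Ico two_pi_pos σ' a
    rw [hσ₂] at hσ'
    -- A negative value can only lie in the second half period. The positivity interval of `-ω`
    -- around it fills that half.
    have hm' : σ₂ ∈ Ioo (a + π) (a + π + π) := by
      rcases cases_Ico hm with h | h | h | h
      · rw [h] at hσ'; exact absurd ha hσ'.ne
      · exact absurd (hpos _ h).1 hσ'.not_gt
      · rw [h] at hσ'; exact absurd ha' hσ'.ne
      · exact h
    obtain ⟨-, b, hb, -, -, hposb⟩ :=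
      hs.neg.component hq (σ := σ₂) (z := z) (by simpa using hσ') (by simp [hz])
    have hab : b = a + π :=
      component_left_eq ha' ha2 hm' hb fun x hx h0 => (hposb x hx).1.ne' (by simp [h0])
    subst hab
    refine ⟨-a, ?_⟩
    refine (eq_of_periodic_of_eqOn hs.periodic ?_ (a := a) fun x hx => ?_).symm
    · intro x
      have := omegaZero_periodic (q := q) (x + -a)
      simpa [add_right_comm] using this
    · simp only [← sub_eq_add_neg]
      rcases cases_Ico hx with h | h | h | h
      · simp [h, ha, omegaZero]
      · rw [omegaZero_eq_of_pos hq (sin_sub_pos h)]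
        exact eq_rpow_of_rpow_eq hq (hpos x h).1.le (hpos x h).2
      · simp [h, ha', omegaZero]
      · rw [show x - a = x - (a + π) + π by ring, omegaZero_add_pi,
          omegaZero_eq_of_pos hq (sin_sub_pos h),
          ← eq_rpow_of_rpow_eq hq (hposb x h).1.le (hposb x h).2]
        simp

end Classification

/-! ### Extrema of a positive periodic profile -/

section Dichotomy

variable {c : ℝ} {w S : ℝ → ℝ}

lemma IsProfileAt.eq_zero_of_deriv {σ : ℝ} (h : IsProfileAt c w S σ) (hd : deriv w σ = 0) :
    S σ = 0 := by
  rw [h.deriv_w.deriv] at hd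
  simpa [h.pos.ne', h.sqrt_pos.ne'] using hd

lemma energy_const (h : ∀ σ, IsProfileAt c w S σ) (x y : ℝ) :
    w x * (√(1 - S x ^ 2) + c - w x / 2) = w y * (√(1 - S y ^ 2) + c - w y / 2) :=
  is_const_of_deriv_eq_zero (fun z => (h z).hasDerivAt_energy.differentiableAt)
    (fun z => (h z).hasDerivAt_energy.deriv) x y

/-- A global periodic profile is constant, or starts at its minimum with a value given by a
parameter `y ∈ (0, 1)`. -/
lemma constant_or_exists_min (h : ∀ σ, IsProfileAt c w S σ) {T : ℝ} (hT : T ≠ 0)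
    (hp : Function.Periodic w T) :
    (-1 < c ∧ ∀ σ, w σ = c + 1) ∨
      ∃ σ y, 0 < y ∧ y < 1 ∧ 0 < y + c ∧ S σ = 0 ∧
        w σ = 1 + c - √((1 + c) ^ 2 - (y + c) ^ 2) := by
  have hw : Continuous w := continuous_iff_continuousAt.2 fun σ => (h σ).deriv_w.continuousAt
  have hK := hp.compact_of_continuous hT hw
  obtain ⟨m, ⟨σ₁, h1⟩, hm⟩ := hK.exists_isLeast (range_nonempty w)
  obtain ⟨M, ⟨σ₂, h2⟩, hM⟩ := hK.exists_isGreatest (range_nonempty w)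
  have hS1 : S σ₁ = 0 := (h σ₁).eq_zero_of_deriv
    (IsLocalMin.deriv_eq_zero (Eventually.of_forall fun x => by rw [h1]; exact hm ⟨x, rfl⟩))
  have hS2 : S σ₂ = 0 := (h σ₂).eq_zero_of_deriv
    (IsLocalMax.deriv_eq_zero (Eventually.of_forall fun x => by rw [h2]; exact hM ⟨x, rfl⟩))
  have hm0 : 0 < m := h1 ▸ (h σ₁).pos
  have hmM : m ≤ M := hm ⟨σ₂, h2⟩
  have hE := energy_const h σ₁ σ₂
  rw [hS1, hS2, h1, h2] at hE
  norm_num at hE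
  -- At both extrema `S = 0`, so `m` and `M` are roots of the same quadratic `w (1 + c - w / 2) =
  -- E`.
  have hE' : (M - m) * (M + m - 2 * (1 + c)) = 0 := by linarith
  rcases hmM.eq_or_lt with heq | hlt
  · left
    have hconst : ∀ x, w x = m := fun x =>
      le_antisymm (by rw [heq]; exact hM ⟨x, rfl⟩) (hm ⟨x, rfl⟩)
    have hS : S = fun _ => 0 := by
      funext x
      refine (h x).eq_zero_of_deriv ?_
      rw [show w = fun _ => m from funext hconst]
      simp
    have := (h σ₁).deriv_S
    rw [hS] at this
    have h0 := this.unique (hasDerivAt_const σ₁ (0 : ℝ))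
    norm_num [h1] at h0
    exact ⟨by linarith, fun x => by rw [hconst]; linarith⟩
  · right
    have hsum : M + m = 2 * (1 + c) := by
      have := (mul_eq_zero.1 hE').resolve_left (by linarith)
      linarith
    -- Since `2 E = m M`, the energy gives `C + c = (g² / w + w) / 2`, which is least at `w = g`.
    -- The value of `C` there is the parameter `y = g - c`: it is positive as a value of `C`, and `y
    -- < 1` is the strict inequality between the two means of `m` and `M`.
    set g := √(m * M) with hg
    have hg2 : g ^ 2 = m * M := sq_sqrt (by nlinarith)
    have hg0 : 0 < g := sqrt_pos.2 (by nlinarith)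
    obtain ⟨σ₃, h3⟩ : g ∈ range w := by
      refine mem_range_of_exists_le_of_exists_ge hw ⟨σ₁, ?_⟩ ⟨σ₂, ?_⟩
      · rw [h1]; exact abs_le_of_sq_le_sq' (by nlinarith) hg0.le |>.2
      · rw [h2]; exact abs_le_of_sq_le_sq' (by nlinarith) (by linarith) |>.2
    have hE3 := energy_const h σ₃ σ₁
    rw [hS1, h1, h3] at hE3
    norm_num at hE3
    have hC := (h σ₃).sqrt_pos
    set C := √(1 - S σ₃ ^ 2)
    have hCg : C = g - c := by
      have : g * (C + c - g) = 0 := by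
        have : m * M = m * (2 * (1 + c) - m) := by rw [← hsum]; ring
        nlinarith
      have := (mul_eq_zero.1 this).resolve_left hg0.ne'
      linarith
    refine ⟨σ₁, g - c, by linarith, ?_, by linarith, hS1, ?_⟩
    · have : g < 1 + c := by
        refine lt_of_pow_lt_pow_left₀ 2 (by linarith) ?_
        have : 1 + c = (M + m) / 2 := by linarith
        rw [this, hg2]
        nlinarith [sq_pos_of_pos (sub_pos.2 hlt)]
      linarith
    · have : (1 + c) ^ 2 - (g - c + c) ^ 2 = ((M - m) / 2) ^ 2 := by
        have : 1 + c = (M + m) / 2 := by linarith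
        rw [sub_add_cancel, hg2, this]; ring
      rw [this, sqrt_sq (by linarith), h1]
      linarith

end Dichotomy

/-! ### Inverting time as a function of the phase -/

section Clock

/-- The autonomous equation `τ' = 1 / R τ` for a positive periodic function `R`. -/
lemma exists_clock {R : ℝ → ℝ} (hR : Continuous R) (hpos : ∀ t, 0 < R t)
    (hper : Function.Periodic R (2 * π)) :
    ∃ τ : ℝ → ℝ, τ 0 = 0 ∧ (∀ σ, HasDerivAt τ (R (τ σ))⁻¹ σ) ∧ Function.Injective τ ∧
      (∀ σ, τ (σ + ∫ t in (0 : ℝ)..(2 * π), R t) = τ σ + 2 * π) ∧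
      ∀ n : ℤ, τ (n * ∫ t in (0 : ℝ)..(2 * π), R t) = n * (2 * π) := by
  -- `G` is the time at which the phase `t` is reached. It is an increasing bijection because `R` is
  -- positive and periodic, and `τ` is its inverse.
  set G : ℝ → ℝ := fun t => ∫ x in (0 : ℝ)..t, R x with hG
  set T := ∫ t in (0 : ℝ)..(2 * π), R t with hT
  have hint : ∀ a b, IntervalIntegrable R MeasureTheory.volume a b := fun a b =>
    hR.intervalIntegrable a b
  have hGd : ∀ t, HasDerivAt G (R t) t := fun t => hR.integral_hasStrictDerivAt 0 t |>.hasDerivAt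
  have hGc : Continuous G := continuous_iff_continuousAt.2 fun t => (hGd t).continuousAt
  have hmono : StrictMono G := strictMono_of_deriv_pos fun t => by
    rw [(hGd t).deriv]; exact hpos t
  have hsurj : Function.Surjective G := hGc.surjective
    (hper.tendsto_atTop_intervalIntegral_of_pos' (hint _ _) hpos two_pi_pos)
    (hper.tendsto_atBot_intervalIntegral_of_pos' (hint _ _) hpos two_pi_pos)
  set e := hmono.orderIsoOfSurjective G hsurj with he
  have heG : ∀ t, e t = G t := fun t => rfl
  have hG0 : G 0 = 0 := by simp [hG]
  have hGadd : ∀ t, G (t + 2 * π) = G t + T := fun t => by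
    simp only [hG, hT]
    rw [← intervalIntegral.integral_add_adjacent_intervals (hint 0 t) (hint t (t + 2 * π)),
      hper.intervalIntegral_add_eq t 0, zero_add]
  have hadd : ∀ σ, e.symm (σ + T) = e.symm σ + 2 * π := fun σ => by
    rw [e.symm_apply_eq, heG, hGadd, ← heG, e.apply_symm_apply]
  refine ⟨e.symm, ?_, fun σ => ?_, e.symm.injective, hadd, fun n => ?_⟩
  · rw [e.symm_apply_eq, heG, hG0]
  · exact HasDerivAt.of_local_left_inverse e.symm.continuous.continuousAt (hGd _) (hpos _).ne'
      (Eventually.of_forall fun y => e.apply_symm_apply y)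
  · have h0 : e.symm 0 = 0 := by rw [e.symm_apply_eq, heG, hG0]
    have h1 : ∀ n : ℕ, ∀ σ, e.symm (σ + n * T) = e.symm σ + n * (2 * π) := by
      intro n
      induction n with
      | zero => simp
      | succ k ih =>
        intro σ
        push_cast
        rw [show σ + (k + 1) * T = σ + k * T + T by ring, hadd, ih]
        ring
    obtain ⟨k, rfl | rfl⟩ := n.eq_nat_or_neg
    · have := h1 k 0
      simpa [h0] using this
    · have := h1 k (-(k * T))
      rw [neg_add_cancel, h0] at this
      push_cast
      rw [neg_mul]
      linarith

end Clock

/-! ### Explicit profiles in terms of the phase -/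

/-- The cosine of the angle of the profile with parameter `y` at the phase `t`. -/
noncomputable def phaseCos (y t : ℝ) : ℝ := √(1 - (1 - y ^ 2) * sin t ^ 2)

/-- The derivative of the angle `σ` with respect to the phase. -/
noncomputable def phaseRate (c y t : ℝ) : ℝ := √((phaseCos y t + y) / (phaseCos y t + y + 2 * c))

/-- The value of `ω ^ q` at the phase `t`. -/
noncomputable def phaseRadius (c y t : ℝ) : ℝ :=
  phaseCos y t + c - √(1 - y ^ 2) * cos t * (phaseRate c y t)⁻¹

/-- The period of the profile with parameter `y`. -/
noncomputable def profilePeriod (c y : ℝ) : ℝ := ∫ t in (0 : ℝ)..(2 * π), phaseRate c y t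

section Phase

variable {c y : ℝ}

lemma phaseCos_eq (y t : ℝ) : phaseCos y t = √(cos t ^ 2 + y ^ 2 * sin t ^ 2) := by
  rw [phaseCos]
  congr 1
  linear_combination -sin_sq_add_cos_sq t

lemma phaseCos_sq (y t : ℝ) : phaseCos y t ^ 2 = 1 - (1 - y ^ 2) * sin t ^ 2 := by
  have h : 0 ≤ cos t ^ 2 + y ^ 2 * sin t ^ 2 := by positivity
  rw [phaseCos_eq, sq_sqrt h]
  linear_combination sin_sq_add_cos_sq t

lemma phaseCos_nonneg (y t : ℝ) : 0 ≤ phaseCos y t := sqrt_nonneg _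

lemma le_phaseCos (hy : 0 ≤ y) (hy1 : y ≤ 1) (t : ℝ) : y ≤ phaseCos y t := by
  rw [phaseCos_eq]
  apply le_sqrt_of_sq_le
  have : y ^ 2 ≤ 1 := by nlinarith
  nlinarith [sin_sq_add_cos_sq t, sq_nonneg (cos t)]

lemma continuous_phaseCos (y : ℝ) : Continuous (phaseCos y) := by
  unfold phaseCos; fun_prop

lemma phaseCos_periodic (y : ℝ) : Function.Periodic (phaseCos y) (2 * π) := fun t => by
  simp [phaseCos]

lemma phaseRate_periodic (c y : ℝ) : Function.Periodic (phaseRate c y) (2 * π) := fun t => by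
  simp [phaseRate, phaseCos_periodic y t]

lemma phaseRadius_periodic (c y : ℝ) : Function.Periodic (phaseRadius c y) (2 * π) := fun t => by
  simp [phaseRadius, phaseCos_periodic y t, phaseRate_periodic c y t]

lemma phase_pos (hy : 0 < y) (hy1 : y ≤ 1) (hc : 0 < y + c) (t : ℝ) :
    0 < phaseCos y t + y ∧ 0 < phaseCos y t + y + 2 * c := by
  have := le_phaseCos hy.le hy1 t
  constructor <;> linarith

lemma phaseRate_pos (hy : 0 < y) (hy1 : y ≤ 1) (hc : 0 < y + c) (t : ℝ) : 0 < phaseRate c y t := by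
  obtain ⟨h1, h2⟩ := phase_pos hy hy1 hc t
  exact sqrt_pos.2 (div_pos h1 h2)

lemma continuous_phaseRate (hy : 0 < y) (hy1 : y ≤ 1) (hc : 0 < y + c) :
    Continuous (phaseRate c y) := by
  have := continuous_phaseCos y
  unfold phaseRate
  exact (Continuous.div (by fun_prop) (by fun_prop) fun t => (phase_pos hy hy1 hc t).2.ne').sqrt

lemma phaseRate_inv_eq (hy : 0 < y) (hy1 : y ≤ 1) (t : ℝ) :
    (phaseRate c y t)⁻¹ = √(1 + 2 * c / (phaseCos y t + y)) := by
  have := (phase_pos (c := 0) hy hy1 (by linarith) t).1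
  rw [phaseRate, ← sqrt_inv, inv_div]
  congr 1
  field_simp

lemma phaseRate_inv_sq (hy : 0 < y) (hy1 : y ≤ 1) (hc : 0 < y + c) (t : ℝ) :
    (phaseRate c y t)⁻¹ ^ 2 = 1 + 2 * c / (phaseCos y t + y) := by
  obtain ⟨h1, h2⟩ := phase_pos hy hy1 hc t
  rw [phaseRate_inv_eq hy hy1, sq_sqrt]
  have : 1 + 2 * c / (phaseCos y t + y) = (phaseCos y t + y + 2 * c) / (phaseCos y t + y) := by
    field_simp
  rw [this]
  exact (div_pos h2 h1).le

/-- Together with `phaseRate_inv_sq` this cancels the factor `C + y` and leaves `S'² = (C - y) (C +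
y + 2c)`, where `C = phaseCos y t`. -/
lemma phase_cos_sq (y t : ℝ) :
    (1 - y ^ 2) * cos t ^ 2 = (phaseCos y t - y) * (phaseCos y t + y) := by
  linear_combination (1 - y ^ 2) * sin_sq_add_cos_sq t - phaseCos_sq y t

/-- The subtracted term is `S'`, and `S'² = (C + c)² - (y + c)²` is smaller than `(C + c)²`. -/
lemma phaseRadius_pos (hy : 0 < y) (hy1 : y < 1) (hc : 0 < y + c) (t : ℝ) :
    0 < phaseRadius c y t := by
  obtain ⟨h1, h2⟩ := phase_pos hy hy1.le hc t
  have h3 := le_phaseCos hy.le hy1.le t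
  have hs : √(1 - y ^ 2) ^ 2 = 1 - y ^ 2 := sq_sqrt (by nlinarith)
  have h4 : (√(1 - y ^ 2) * cos t * (phaseRate c y t)⁻¹) ^ 2 < (phaseCos y t + c) ^ 2 := by
    rw [mul_pow, mul_pow, hs, phase_cos_sq, phaseRate_inv_sq hy hy1.le hc]
    have : (phaseCos y t - y) * (phaseCos y t + y) * (1 + 2 * c / (phaseCos y t + y)) =
        (phaseCos y t - y) * (phaseCos y t + y + 2 * c) := by field_simp
    rw [this]
    nlinarith [sq_pos_of_pos hc]
  have := (abs_lt_of_sq_lt_sq' h4 (by linarith)).2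
  rw [phaseRadius]
  linarith

lemma hasDerivAt_phaseCos (hy : 0 < y) (hy1 : y ≤ 1) (t : ℝ) :
    HasDerivAt (phaseCos y) (-((1 - y ^ 2) * sin t * cos t / phaseCos y t)) t := by
  have hC : 0 < phaseCos y t := hy.trans_le (le_phaseCos hy.le hy1 t)
  have h0 : 1 - (1 - y ^ 2) * sin t ^ 2 ≠ 0 := by
    rw [← phaseCos_sq]; positivity
  have h1 := ((((hasDerivAt_sin t).pow 2).const_mul (1 - y ^ 2)).const_sub 1).sqrt h0
  refine h1.congr_deriv ?_
  change _ / (2 * phaseCos y t) = _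
  field_simp
  norm_num
  ring

lemma hasDerivAt_phaseRadius (hy : 0 < y) (hy1 : y < 1) (hc : 0 < y + c) (t : ℝ) :
    HasDerivAt (phaseRadius c y)
      (phaseRadius c y t * (√(1 - y ^ 2) * sin t) / phaseCos y t * phaseRate c y t) t := by
  obtain ⟨h1, h2⟩ := phase_pos hy hy1.le hc t
  have hC : 0 < phaseCos y t := hy.trans_le (le_phaseCos hy.le hy1.le t)
  have hCd := hasDerivAt_phaseCos hy hy1.le t
  have hF2 := phaseRate_inv_sq hy hy1.le hc t
  have hRpos := phaseRate_pos hy hy1.le hc t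
  have hFe := funext fun t => phaseRate_inv_eq (c := c) hy hy1.le t
  have hFd : HasDerivAt (fun t => (phaseRate c y t)⁻¹)
      (-(2 * c) * -((1 - y ^ 2) * sin t * cos t / phaseCos y t) / (phaseCos y t + y) ^ 2 /
        (2 * (phaseRate c y t)⁻¹)) t := by
    have h3 := ((((hCd.add_const y).fun_inv h1.ne').const_mul (2 * c)).const_add 1).sqrt (by
      have := pow_pos (inv_pos.2 hRpos) 2
      rw [hF2, div_eq_mul_inv] at this
      exact this.ne')
    rw [hFe, phaseRate_inv_eq hy hy1.le]
    simp only [div_eq_mul_inv (2 * c)]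
    refine h3.congr_deriv ?_
    ring
  have hs : √(1 - y ^ 2) ^ 2 = 1 - y ^ 2 := sq_sqrt (by nlinarith)
  have hcos := phase_cos_sq y t
  have hd := (hCd.add_const c).sub (((hasDerivAt_cos t).const_mul √(1 - y ^ 2)).mul hFd)
  refine hd.congr_deriv ?_
  rw [phaseRadius]
  have hRF : phaseRate c y t = ((phaseRate c y t)⁻¹)⁻¹ := (inv_inv _).symm
  have hF := inv_pos.2 hRpos
  set F := (phaseRate c y t)⁻¹
  set C := phaseCos y t
  set s := √(1 - y ^ 2)
  rw [← hs] at hcos ⊢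
  -- Here `hcos` replaces `s² cos² t` by `(C - y) (C + y)`, so that every term becomes a rational
  -- multiple of `s sin t`.
  have e1 : s * cos t * (-(2 * c) * -(s ^ 2 * sin t * cos t / C) / (C + y) ^ 2 / (2 * F)) =
      c * s * sin t * (C - y) / (C * (C + y)) / F := by
    have : s * cos t * (-(2 * c) * -(s ^ 2 * sin t * cos t / C) / (C + y) ^ 2 / (2 * F)) =
      c * s * sin t * (s ^ 2 * cos t ^ 2) / (C * (C + y) ^ 2) / F := by
      field_simp
    rw [this, hcos]
    field_simp
  have e2 : s * -sin t * F = -(s * sin t * (1 + 2 * c / (C + y))) / F := by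
    rw [← hF2]; field_simp
  rw [e1, e2, hRF]
  field_simp
  ring

/-- The explicit profiles. -/
lemma isProfileAt_phase (hy : 0 < y) (hy1 : y < 1) (hc : 0 < y + c) {τ : ℝ → ℝ} {σ : ℝ}
    (hτ : HasDerivAt τ (phaseRate c y (τ σ))⁻¹ σ) :
    IsProfileAt c (fun x => phaseRadius c y (τ x)) (fun x => √(1 - y ^ 2) * sin (τ x)) σ := by
  have hs : √(1 - y ^ 2) ^ 2 = 1 - y ^ 2 := sq_sqrt (by nlinarith)
  have hC : 0 < phaseCos y (τ σ) := hy.trans_le (le_phaseCos hy.le hy1.le _)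
  have h1 : √(1 - (√(1 - y ^ 2) * sin (τ σ)) ^ 2) = phaseCos y (τ σ) := by
    rw [mul_pow, hs, phaseCos]
  have hR := phaseRate_pos hy hy1.le hc (τ σ)
  refine ⟨phaseRadius_pos hy hy1 hc _, ?_, ?_, ?_⟩
  · have := phaseCos_sq y (τ σ)
    have := pow_pos hC 2
    rw [mul_pow, hs]
    linarith
  · refine ((hasDerivAt_phaseRadius hy hy1 hc (τ σ)).comp σ hτ).congr_deriv ?_
    rw [h1]
    field_simp
  · refine (((hasDerivAt_sin (τ σ)).comp σ hτ).const_mul √(1 - y ^ 2)).congr_deriv ?_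
    rw [h1, phaseRadius]
    ring

/-- These phases are the extrema: the minimum for `cos t = 1`, the maximum for `cos t = -1`. -/
lemma phaseRadius_of_sin_eq_zero {t : ℝ} (hy : 0 < y) (hy1 : y < 1) (ht : sin t = 0) :
    phaseRadius c y t = 1 + c - cos t * √((1 + c) ^ 2 - (y + c) ^ 2) := by
  have hC : phaseCos y t = 1 := by simp [phaseCos, ht]
  have h0 : (0 : ℝ) ≤ 1 - y ^ 2 := by nlinarith
  rw [phaseRadius, phaseRate_inv_eq hy hy1.le, hC]
  have : √(1 - y ^ 2) * cos t * √(1 + 2 * c / (1 + y)) =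
      cos t * √((1 - y ^ 2) * (1 + 2 * c / (1 + y))) := by
    rw [sqrt_mul h0]; ring
  rw [this]
  congr 3
  field_simp
  ring

end Phase

/-! ### Uniqueness for periodic profiles -/

section Uniqueness

variable {c : ℝ}

/-- The vector field is singular at `S = ±1`. Periodicity confines the orbit to a compact box away
from there. -/
lemma profile_bounds {w S : ℝ → ℝ} (h : ∀ σ, IsProfileAt c w S σ) {T : ℝ} (hT : T ≠ 0)
    (hw : Function.Periodic w T) (hS : Function.Periodic S T) :
    ∃ m M s, 0 < m ∧ s < 1 ∧ ∀ σ, w σ ∈ Icc m M ∧ S σ ∈ Icc (-s) s := by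
  have hwc : Continuous w := continuous_iff_continuousAt.2 fun σ => (h σ).deriv_w.continuousAt
  have hSc : Continuous S := continuous_iff_continuousAt.2 fun σ => (h σ).deriv_S.continuousAt
  have hK := hw.compact_of_continuous hT hwc
  obtain ⟨m, ⟨σ₁, h1⟩, hm⟩ := hK.exists_isLeast (range_nonempty w)
  obtain ⟨M, -, hM⟩ := hK.exists_isGreatest (range_nonempty w)
  have hS' : Function.Periodic (fun σ => |S σ|) T := fun σ => by simp only [hS σ]
  obtain ⟨s, ⟨σ₂, h2⟩, hs⟩ :=
    (hS'.compact_of_continuous hT hSc.abs).exists_isGreatest (range_nonempty _)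
  refine ⟨m, M, s, h1 ▸ (h σ₁).pos, ?_, fun σ => ⟨⟨hm ⟨σ, rfl⟩, hM ⟨σ, rfl⟩⟩, ?_⟩⟩
  · rw [← h2]
    exact (sq_lt_one_iff_abs_lt_one _).1 (h σ₂).sq_lt
  · exact abs_le.1 (hs ⟨σ, rfl⟩)

lemma profile_unique {w₁ S₁ w₂ S₂ : ℝ → ℝ} (h₁ : ∀ σ, IsProfileAt c w₁ S₁ σ)
    (h₂ : ∀ σ, IsProfileAt c w₂ S₂ σ) {T₁ T₂ : ℝ} (hT₁ : T₁ ≠ 0) (hT₂ : T₂ ≠ 0)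
    (hw₁ : Function.Periodic w₁ T₁) (hS₁ : Function.Periodic S₁ T₁)
    (hw₂ : Function.Periodic w₂ T₂) (hS₂ : Function.Periodic S₂ T₂)
    {σ₀ : ℝ} (hw : w₁ σ₀ = w₂ σ₀) (hS : S₁ σ₀ = S₂ σ₀) : w₁ = w₂ := by
  obtain ⟨m₁, M₁, s₁, hm₁, hs₁, hb₁⟩ := profile_bounds h₁ hT₁ hw₁ hS₁
  obtain ⟨m₂, M₂, s₂, hm₂, hs₂, hb₂⟩ := profile_bounds h₂ hT₂ hw₂ hS₂
  set m := min m₁ m₂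
  set M := max M₁ M₂
  set s := max s₁ s₂
  have hm : 0 < m := lt_min hm₁ hm₂
  have hs : s < 1 := max_lt hs₁ hs₂
  -- A common box for both orbits. It is convex and compact and the field is `C¹` on it, hence
  -- Lipschitz.
  set B : Set (ℝ × ℝ) := Icc m M ×ˢ Icc (-s) s
  have hB : ∀ p ∈ B, 1 - p.2 ^ 2 ≠ 0 := by
    rintro ⟨a, b⟩ ⟨-, hb⟩
    have : |b| < 1 := (abs_le.2 hb).trans_lt hs
    have := (sq_lt_one_iff_abs_lt_one b).2 this
    simp only
    linarith
  set v : ℝ × ℝ → ℝ × ℝ := fun p => (p.1 * p.2 / √(1 - p.2 ^ 2), √(1 - p.2 ^ 2) - p.1 + c)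
  have hroot : ContDiffOn ℝ 1 (fun p : ℝ × ℝ => √(1 - p.2 ^ 2)) B :=
    ContDiffOn.sqrt (by fun_prop) hB
  have hv : ContDiffOn ℝ 1 v B := by
    refine ContDiffOn.prodMk (ContDiffOn.div (by fun_prop) hroot fun p hp => ?_)
      ((hroot.sub (by fun_prop)).add contDiffOn_const)
    obtain ⟨-, hb⟩ := hp
    have : |p.2| < 1 := (abs_le.2 hb).trans_lt hs
    have := (sq_lt_one_iff_abs_lt_one p.2).2 this
    exact (Real.sqrt_pos.2 (by linarith)).ne'
  obtain ⟨K, hK⟩ := hv.exists_lipschitzOnWith one_ne_zero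
    ((convex_Icc m M).prod (convex_Icc (-s) s)) (isCompact_Icc.prod isCompact_Icc)
  have hmem₁ : ∀ σ, (w₁ σ, S₁ σ) ∈ B := fun σ =>
    ⟨Icc_subset_Icc (min_le_left _ _) (le_max_left _ _) (hb₁ σ).1,
      Icc_subset_Icc (neg_le_neg (le_max_left _ _)) (le_max_left _ _) (hb₁ σ).2⟩
  have hmem₂ : ∀ σ, (w₂ σ, S₂ σ) ∈ B := fun σ =>
    ⟨Icc_subset_Icc (min_le_right _ _) (le_max_right _ _) (hb₂ σ).1,
      Icc_subset_Icc (neg_le_neg (le_max_right _ _)) (le_max_right _ _) (hb₂ σ).2⟩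
  have := ODE_solution_unique_univ (v := fun _ => v) (s := fun _ => B) (K := K)
    (f := fun σ => (w₁ σ, S₁ σ)) (g := fun σ => (w₂ σ, S₂ σ)) (t₀ := σ₀) (fun _ => hK)
    (fun σ => ⟨(h₁ σ).deriv_w.prodMk (h₁ σ).deriv_S, hmem₁ σ⟩)
    (fun σ => ⟨(h₂ σ).deriv_w.prodMk (h₂ σ).deriv_S, hmem₂ σ⟩) (by simp only [hw, hS])
  funext σ
  exact congrArg Prod.fst (congrFun this σ)

end Uniqueness

/-! ### The family of profiles and their periods -/

section Profile

variable {c y : ℝ}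

lemma profilePeriod_pos (hy : 0 < y) (hy1 : y < 1) (hc : 0 < y + c) : 0 < profilePeriod c y :=
  intervalIntegral.intervalIntegral_pos_of_pos
    ((continuous_phaseRate hy hy1.le hc).intervalIntegrable _ _)
    (phaseRate_pos hy hy1.le hc) two_pi_pos

/-- The explicit profiles exist, and their periods are the multiples of `profilePeriod c y`. -/
lemma exists_profile (hy : 0 < y) (hy1 : y < 1) (hc : 0 < y + c) :
    ∃ w S : ℝ → ℝ, (∀ σ, IsProfileAt c w S σ) ∧ S 0 = 0 ∧
      w 0 = 1 + c - √((1 + c) ^ 2 - (y + c) ^ 2) ∧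
      Function.Periodic w (profilePeriod c y) ∧ Function.Periodic S (profilePeriod c y) ∧
      ∀ x, Function.Periodic w x → ∃ n : ℤ, x = n * profilePeriod c y := by
  obtain ⟨τ, h0, hd, hinj, hadd, hmul⟩ := exists_clock (continuous_phaseRate hy hy1.le hc)
    (phaseRate_pos hy hy1.le hc) (phaseRate_periodic c y)
  have hprof := fun σ => isProfileAt_phase hy hy1 hc (hd σ)
  have hw0 : phaseRadius c y (τ 0) = 1 + c - √((1 + c) ^ 2 - (y + c) ^ 2) := by
    rw [phaseRadius_of_sin_eq_zero hy hy1 (by simp [h0]), h0, cos_zero, one_mul]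
  refine ⟨_, _, hprof, by simp [h0], hw0, fun σ => ?_, fun σ => ?_, fun x hx => ?_⟩
  · simp only [profilePeriod, hadd, phaseRadius_periodic c y (τ σ)]
  · simp only [profilePeriod, hadd, sin_add_two_pi]
  -- A period `x` carries the critical point `0` to a critical point, so `sin (τ x) = 0`. Since `w
  -- x` is again the minimum, `cos (τ x) = 1` and `τ x` is a multiple of `2π`.
  · have hS0 : deriv (fun x => phaseRadius c y (τ x)) 0 = 0 := by
      rw [(hprof 0).deriv_w.deriv]; simp [h0]
    have hSx : deriv (fun x => phaseRadius c y (τ x)) x = 0 := by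
      rw [← hS0]
      have h1 := deriv_comp_add_const (fun x => phaseRadius c y (τ x)) x 0
      rw [zero_add] at h1
      rw [← h1]
      congr 1
      exact funext hx
    have hsin : sin (τ x) = 0 := by
      have h1 := (hprof x).eq_zero_of_deriv hSx
      have h2 : √(1 - y ^ 2) ≠ 0 := (Real.sqrt_pos.2 (by nlinarith)).ne'
      exact (mul_eq_zero.1 h1).resolve_left h2
    have hwx := hx 0
    simp only [zero_add] at hwx
    rw [hw0, phaseRadius_of_sin_eq_zero hy hy1 hsin] at hwx
    have hroot : 0 < √((1 + c) ^ 2 - (y + c) ^ 2) := Real.sqrt_pos.2 (by nlinarith)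
    have hcos : cos (τ x) = 1 := by
      have : (cos (τ x) - 1) * √((1 + c) ^ 2 - (y + c) ^ 2) = 0 := by linarith
      have := (mul_eq_zero.1 this).resolve_right hroot.ne'
      linarith
    obtain ⟨n, hn⟩ := (cos_eq_one_iff _).1 hcos
    refine ⟨n, hinj ?_⟩
    rw [profilePeriod, hmul, hn]

end Profile

/-! ### Trichotomy for nonnegative solutions -/

section PositiveSolutions

variable {q c : ℝ} {ω : ℝ → ℝ}

lemma const_mem_positiveSolutions (hq : 0 < q) (hc : -1 < c) :
    (fun _ : ℝ => (c + 1) ^ (1 / q)) ∈ positiveSolutions 1 q c := by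
  refine rpow_mem_positiveSolutions hq (w := fun _ => c + 1) (S := fun _ => 0) (fun σ => ?_)
    fun σ => rfl
  refine ⟨by linarith, by simp, ?_, ?_⟩
  · simpa using hasDerivAt_const σ (c + 1)
  · simpa using hasDerivAt_const σ (0 : ℝ)

/-- Nonnegative solutions are constant, or start at their minimum with an explicit value, or
have zeros. -/
lemma positive_trichotomy (hq : 0 < q) (h : ω ∈ positiveSolutions 1 q c) :
    (c = 0 ∧ q < 1 ∧ ω ∈ rotations (omegaZeroPos q)) ∨
    (-1 < c ∧ ω = fun _ => (c + 1) ^ (1 / q)) ∨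
    ∃ σ₀ y, 0 < y ∧ y < 1 ∧ 0 < y + c ∧
      ∀ w S : ℝ → ℝ, (∀ σ, IsProfileAt c w S σ) → S 0 = 0 →
        w 0 = 1 + c - √((1 + c) ^ 2 - (y + c) ^ 2) → ∀ T ≠ 0, Function.Periodic w T →
        Function.Periodic S T →
        ω = (fun σ => w (σ + -σ₀) ^ (1 / q)) ∧ Function.Periodic w (2 * π) := by
  by_cases hz : ∃ z, ω z = 0
  · obtain ⟨z, hz⟩ := hz
    exact Or.inl (positive_with_zero hq h hz)
  right
  obtain ⟨hs, hnn, -⟩ := h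
  have hpos : ∀ σ, 0 < ω σ := fun σ =>
    lt_of_le_of_ne (hnn σ) fun h0 => hz ⟨σ, h0.symm⟩
  have hprof := fun σ => hs.isProfileAt hq (hpos σ)
  have hpw : Function.Periodic (fun x => ω x ^ q) (2 * π) := fun σ => by
    simp only [hs.periodic σ]
  have hback : ∀ σ, ω σ = (ω σ ^ q) ^ (1 / q) := fun σ =>
    eq_rpow_of_rpow_eq hq (hnn σ) rfl
  rcases constant_or_exists_min hprof two_pi_pos.ne' hpw with ⟨hc, hconst⟩ | ⟨σ₀, y, h1, h2, h3, h4, h5⟩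
  · left
    refine ⟨hc, funext fun σ => ?_⟩
    rw [hback, hconst]
  · right
    refine ⟨σ₀, y, h1, h2, h3, fun w S hw hS0 hw0 T hT hwT hST => ?_⟩
    -- Any periodic profile that starts at the same minimum, moved to `σ₀`, has the same data there
    -- as the solution.
    have heq := profile_unique hprof (fun σ => (hw (σ + -σ₀)).shift) two_pi_pos.ne' hT hpw
      (flux_periodic hs.periodic) (fun σ => by
        have := hwT (σ + -σ₀)
        simpa [add_right_comm] using this) (fun σ => by
        have := hST (σ + -σ₀)
        simpa [add_right_comm] using this) (σ₀ := σ₀) (by simpa [hw0] using h5)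
      (by simpa [hS0] using h4)
    constructor
    · funext σ
      rw [hback]
      exact congrArg (· ^ (1 / q)) (congrFun heq σ)
    · intro σ
      have e1 := congrFun heq (σ + σ₀)
      have e2 := congrFun heq (σ + σ₀ + 2 * π)
      simp only [hs.periodic (σ + σ₀)] at e1 e2
      rw [e1] at e2
      simp only [add_neg_cancel_right] at e2
      rw [e2]
      congr 1
      ring

end PositiveSolutions

/-! ### Dependence of the period on the parameter -/

section Period

variable {c y : ℝ}

lemma two_pi_lt_profilePeriod (hc0 : c < 0) (hy1 : y < 1) (hc : 0 < y + c) :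
    2 * π < profilePeriod c y := by
  have hy : 0 < y := by linarith
  have hlt : ∀ t, 1 < phaseRate c y t := fun t => by
    obtain ⟨h1, h2⟩ := phase_pos hy hy1.le hc t
    rw [phaseRate, lt_sqrt zero_le_one, one_pow, one_lt_div h2]
    linarith
  have h1 : ∫ _ in (0 : ℝ)..(2 * π), (1 : ℝ) = 2 * π := by simp
  refine h1.symm.trans_lt ?_
  exact intervalIntegral.integral_lt_integral_of_continuousOn_of_le_of_exists_lt two_pi_pos
    continuousOn_const (continuous_phaseRate hy hy1.le hc).continuousOn
    (fun t _ => (hlt t).le) ⟨0, ⟨le_rfl, two_pi_pos.le⟩, hlt 0⟩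

/-- Taking `|y|` keeps the denominator at least `2c` for every real `y`. The period is thus
continuous up to `y = 0`, which is not itself the parameter of a profile. -/
lemma continuous_phaseRate_abs (hc : 0 < c) :
    Continuous (Function.uncurry fun y t : ℝ => phaseRate c |y| t) := by
  have h1 : Continuous fun p : ℝ × ℝ => phaseCos |p.1| p.2 := by
    unfold phaseCos; fun_prop
  have h2 : (Function.uncurry fun y t : ℝ => phaseRate c |y| t) = fun p : ℝ × ℝ =>
      √((phaseCos |p.1| p.2 + |p.1|) / (phaseCos |p.1| p.2 + |p.1| + 2 * c)) := by
    funext p; rfl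
  rw [h2]
  refine (Continuous.div (by fun_prop) (by fun_prop) fun p => ?_).sqrt
  have := phaseCos_nonneg |p.1| p.2
  positivity

lemma continuous_profilePeriod_abs (hc : 0 < c) : Continuous fun y : ℝ => profilePeriod c |y| :=
  intervalIntegral.continuous_parametric_intervalIntegral_of_continuous'
    (continuous_phaseRate_abs hc) 0 (2 * π)

lemma continuous_phaseRate_of_pos (hc : 0 < c) (hy : 0 ≤ y) : Continuous (phaseRate c y) := by
  have := (continuous_phaseRate_abs hc).comp (Continuous.prodMk_right y)
  simpa [Function.comp_def, abs_of_nonneg hy] using this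

/-- For `c > 0` the map `x ↦ x / (x + 2c)` is increasing on `x ≥ 0`, and `phaseCos y t + y`
increases strictly with `y`. -/
lemma phaseRate_lt (hc : 0 < c) {y₁ y₂ : ℝ} (h0 : 0 ≤ y₁) (h : y₁ < y₂) (t : ℝ) :
    phaseRate c y₁ t < phaseRate c y₂ t := by
  have h1 := phaseCos_nonneg y₁ t
  have h2 := phaseCos_nonneg y₂ t
  have h3 : phaseCos y₁ t ≤ phaseCos y₂ t := by
    rw [phaseCos_eq, phaseCos_eq]
    gcongr
  refine sqrt_lt_sqrt (by positivity) ?_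
  rw [div_lt_div_iff₀ (by positivity) (by linarith)]
  nlinarith

lemma profilePeriod_lt (hc : 0 < c) {y₁ y₂ : ℝ} (h0 : 0 ≤ y₁) (h : y₁ < y₂) :
    profilePeriod c y₁ < profilePeriod c y₂ :=
  intervalIntegral.integral_lt_integral_of_continuousOn_of_le_of_exists_lt two_pi_pos
    (continuous_phaseRate_of_pos hc h0).continuousOn
    (continuous_phaseRate_of_pos hc (h0.trans h.le)).continuousOn
    (fun t _ => (phaseRate_lt hc h0 h t).le)
    ⟨0, ⟨le_rfl, two_pi_pos.le⟩, phaseRate_lt hc h0 h 0⟩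

/-- The limit of small oscillations around the constant solution: at `y = 1` the rate does not
depend on the phase. -/
lemma profilePeriod_one (hc : 0 < c) : profilePeriod c 1 = 2 * π / √(c + 1) := by
  have h1 : phaseRate c 1 = fun _ => (√(c + 1))⁻¹ := by
    funext t
    have : phaseCos 1 t = 1 := by simp [phaseCos]
    rw [phaseRate, this, ← sqrt_inv]
    congr 1
    field_simp
    ring
  rw [profilePeriod, h1]
  simp [div_eq_mul_inv]

lemma phaseCos_zero (t : ℝ) : phaseCos 0 t = |cos t| := by
  rw [phaseCos_eq, ← sqrt_sq_eq_abs]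
  congr 1
  ring

/-- At `y = 0` the phase cosine is `|cos t|`, so the four quarter periods contribute equally. -/
lemma profilePeriod_zero (hc : 0 < c) : profilePeriod c 0 = 4 * periodIntegral c := by
  set g := phaseRate c 0 with hg
  have hgc : Continuous g := continuous_phaseRate_of_pos hc le_rfl
  have hint : ∀ a b, IntervalIntegrable g MeasureTheory.volume a b := fun a b =>
    hgc.intervalIntegrable a b
  have hper : Function.Periodic g π := fun t => by
    simp [hg, phaseRate, phaseCos_zero, cos_add_pi]
  have hrefl : ∀ t, g (π - t) = g t := fun t => by
    simp [hg, phaseRate, phaseCos_zero, cos_pi_sub]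
  have h1 : ∫ t in (0 : ℝ)..(2 * π), g t = (∫ t in (0 : ℝ)..π, g t) + ∫ t in (0 : ℝ)..π, g t := by
    rw [← intervalIntegral.integral_add_adjacent_intervals (hint 0 π) (hint π (2 * π))]
    congr 1
    have := hper.intervalIntegral_add_eq π 0
    rwa [zero_add, ← two_mul] at this
  have h2 : ∫ t in (0 : ℝ)..π, g t =
      (∫ t in (0 : ℝ)..(π / 2), g t) + ∫ t in (0 : ℝ)..(π / 2), g t := by
    rw [← intervalIntegral.integral_add_adjacent_intervals (hint 0 (π / 2)) (hint (π / 2) π)]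
    congr 1
    have := intervalIntegral.integral_comp_sub_left (a := 0) (b := π / 2) g π
    simp only [hrefl, sub_zero] at this
    rw [this]
    congr 1
    ring
  have h3 : periodIntegral c = ∫ t in (0 : ℝ)..(π / 2), g t := by
    rw [periodIntegral]
    refine intervalIntegral.integral_congr fun t ht => ?_
    rw [uIcc_of_le (by positivity)] at ht
    have : 0 ≤ cos t := cos_nonneg_of_mem_Icc ⟨by linarith [ht.1, pi_pos], ht.2⟩
    simp [hg, phaseRate, phaseCos_zero, abs_of_nonneg this]
  rw [profilePeriod, h1, h2, h3]
  ring

lemma periodIntegral_pos (hc : 0 < c) : 0 < periodIntegral c := by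
  have h0 : (0 : ℝ) < π / 2 := by positivity
  have hcont : ContinuousOn (fun θ => √(cos θ / (cos θ + 2 * c))) (uIcc 0 (π / 2)) := by
    rw [uIcc_of_le h0.le]
    refine (ContinuousOn.div (by fun_prop) (by fun_prop) fun θ hθ => ?_).sqrt
    have : 0 ≤ cos θ := cos_nonneg_of_mem_Icc ⟨by linarith [hθ.1], hθ.2⟩
    positivity
  refine intervalIntegral.intervalIntegral_pos_of_pos_on hcont.intervalIntegrable
    (fun θ hθ => ?_) h0
  have : 0 < cos θ := cos_pos_of_mem_Ioo ⟨by linarith [hθ.1], hθ.2⟩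
  positivity

lemma exists_profilePeriod_eq (hc : 0 < c) {T : ℝ} (h0 : 4 * periodIntegral c < T)
    (h1 : T < 2 * π / √(c + 1)) : ∃ y, 0 < y ∧ y < 1 ∧ profilePeriod c y = T := by
  have := intermediate_value_Ioo zero_le_one (continuous_profilePeriod_abs hc).continuousOn
  simp only [abs_zero, abs_one, profilePeriod_zero hc, profilePeriod_one hc] at this
  obtain ⟨y, hy, hyT⟩ := this ⟨h0, h1⟩
  simp only [abs_of_pos hy.1] at hyT
  exact ⟨y, hy.1, hy.2, hyT⟩

end Period

/-! ### Rotations of solutions -/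

section Rotations

variable {q c : ℝ} {ω : ℝ → ℝ}

lemma rotation_mem_positiveSolutions (h : ω ∈ positiveSolutions 1 q c) (ψ : ℝ) :
    (fun σ => ω (σ + ψ)) ∈ positiveSolutions 1 q c := by
  obtain ⟨h1, h2, h3⟩ := h
  exact ⟨h1.shift ψ, fun σ => h2 _, h3.preimage (Homeomorph.addRight ψ).isOpenMap⟩

lemma rotations_subset (h : ω ∈ positiveSolutions 1 q c) :
    rotations ω ⊆ positiveSolutions 1 q c := by
  rintro _ ⟨ψ, rfl⟩
  exact rotation_mem_positiveSolutions h ψ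

lemma rotation_mem_signChangingSolutions (h : ω ∈ signChangingSolutions 1 q c) (ψ : ℝ) :
    (fun σ => ω (σ + ψ)) ∈ signChangingSolutions 1 q c := by
  obtain ⟨h1, ⟨a, ha⟩, ⟨b, hb⟩⟩ := h
  exact ⟨h1.shift ψ, ⟨a - ψ, by simpa using ha⟩, ⟨b - ψ, by simpa using hb⟩⟩

lemma signChangingSolutions_eq (hq : 0 < q) (hq1 : q ≤ 1) :
    signChangingSolutions 1 q 0 = rotations (omegaZero q) := by
  refine Subset.antisymm (fun ω h => (signChanging_classification hq h).2.2) ?_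
  rintro _ ⟨ψ, rfl⟩
  exact rotation_mem_signChangingSolutions (omegaZero_mem hq hq1) ψ

end Rotations

/-! ### The case `c = 0` -/

section Circles

variable {q : ℝ}

/-- For `c = 0` the phase is the angle itself. The profile is the polar equation of a unit circle
whose centre lies at distance `K = √(1 - y²) < 1` from the origin. -/
lemma phaseRate_zero {y : ℝ} (hy : 0 < y) (hy1 : y < 1) (t : ℝ) : phaseRate 0 y t = 1 := by
  have := (phase_pos (c := 0) hy hy1.le (by linarith) t).1.ne'
  rw [phaseRate, mul_zero, add_zero, div_self this, sqrt_one]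

lemma isProfileAt_circle {y : ℝ} (hy : 0 < y) (hy1 : y < 1) (σ : ℝ) :
    IsProfileAt 0 (phaseRadius 0 y) (fun x => √(1 - y ^ 2) * sin x) σ :=
  isProfileAt_phase (τ := fun x => x) hy hy1 (by linarith)
    (by rw [phaseRate_zero hy hy1, inv_one]; exact hasDerivAt_id σ)

lemma phaseRadius_zero_rpow {y : ℝ} (hy : 0 < y) (hy1 : y < 1) :
    (fun σ => phaseRadius 0 y σ ^ (1 / q)) = omegaK q √(1 - y ^ 2) := by
  funext σ
  have : √(1 - y ^ 2) ^ 2 = 1 - y ^ 2 := sq_sqrt (by nlinarith)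
  rw [omegaK, phaseRadius, phaseRate_zero hy hy1, phaseCos, this]
  simp

lemma omegaK_mem (hq : 0 < q) {K : ℝ} (hK : K ∈ Ioo (0 : ℝ) 1) :
    omegaK q K ∈ positiveSolutions 1 q 0 := by
  have hK2 : K ^ 2 < 1 := by nlinarith [hK.1, hK.2]
  have hy : 0 < √(1 - K ^ 2) := sqrt_pos.2 (by linarith)
  have hy1 : √(1 - K ^ 2) < 1 := by
    rw [sqrt_lt' one_pos]
    nlinarith [hK.1]
  have hKy : √(1 - √(1 - K ^ 2) ^ 2) = K := by
    rw [sq_sqrt (by linarith), sub_sub_cancel, sqrt_sq hK.1.le]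
  have := rpow_mem_positiveSolutions hq (isProfileAt_circle hy hy1) (phaseRadius_periodic 0 _)
  rwa [phaseRadius_zero_rpow hy hy1, hKy] at this

lemma positiveSolutions_zero_subset (hq : 0 < q) {ω : ℝ → ℝ}
    (h : ω ∈ positiveSolutions 1 q 0) :
    ω ∈ ({fun _ : ℝ => 1} ∪ ⋃ K ∈ Ioo (0 : ℝ) 1, rotations (omegaK q K)) ∨
      q < 1 ∧ ω ∈ rotations (omegaZeroPos q) := by
  rcases positive_trichotomy hq h with ⟨-, h1, h2⟩ | ⟨-, h1⟩ | ⟨σ₀, y, hy, hy1, -, huniq⟩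
  · exact Or.inr ⟨h1, h2⟩
  · left; left
    rw [h1]
    simp
  · left; right
    have h1 := huniq _ _ (isProfileAt_circle hy hy1) (by simp)
      (by rw [phaseRadius_of_sin_eq_zero hy hy1 sin_zero, cos_zero, one_mul])
      (2 * π) two_pi_pos.ne' (phaseRadius_periodic 0 y) (fun x => by simp)
    have hK0 : 0 < √(1 - y ^ 2) := sqrt_pos.2 (by nlinarith)
    have hK1 : √(1 - y ^ 2) < 1 := by
      rw [sqrt_lt' one_pos]
      nlinarith
    simp only [mem_iUnion]
    refine ⟨_, ⟨hK0, hK1⟩, -σ₀, ?_⟩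
    rw [h1.1, ← phaseRadius_zero_rpow hy hy1]

lemma positiveSolutions_zero_supset (hq : 0 < q) :
    ({fun _ : ℝ => 1} ∪ ⋃ K ∈ Ioo (0 : ℝ) 1, rotations (omegaK q K)) ⊆
      positiveSolutions 1 q 0 := by
  refine union_subset (singleton_subset_iff.2 ?_) (iUnion₂_subset fun K hK => ?_)
  · simpa using const_mem_positiveSolutions hq (c := 0) (by norm_num)
  · exact rotations_subset (omegaK_mem hq hK)

end Circles

/-! ### The case `c ≠ 0` -/

section NonzeroCoefficient

variable {q c : ℝ}

lemma one_le_of_pos_mul {n : ℤ} {T x : ℝ} (hT : 0 < T) (hx : 0 < x) (h : x = n * T) : 1 ≤ n := by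
  have : (0 : ℝ) < n := by
    by_contra! hn
    nlinarith
  exact_mod_cast this

lemma positiveSolutions_of_neg (hq : 0 < q) (hc0 : c < 0) {ω : ℝ → ℝ}
    (h : ω ∈ positiveSolutions 1 q c) : -1 < c ∧ ω = fun _ => (c + 1) ^ (1 / q) := by
  rcases positive_trichotomy hq h with ⟨h1, -⟩ | h1 | ⟨σ₀, y, hy, hy1, hyc, huniq⟩
  · exact absurd h1 hc0.ne
  · exact h1
  · exfalso
    obtain ⟨w, S, hw, hS0, hw0, hwT, hST, hall⟩ := exists_profile hy hy1 hyc
    have hT := profilePeriod_pos hy hy1 hyc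
    -- `2π` would be a positive multiple of a period which is larger than `2π`.
    obtain ⟨n, hn⟩ := hall _ (huniq w S hw hS0 hw0 _ hT.ne' hwT hST).2
    have h1 := one_le_of_pos_mul hT two_pi_pos hn
    have h2 := two_pi_lt_profilePeriod hc0 hy1 hyc
    have h3 : (1 : ℝ) ≤ n := by exact_mod_cast h1
    nlinarith

lemma isLeastPeriod_rpow (hq : 0 < q) {w : ℝ → ℝ} (hpos : ∀ σ, 0 < w σ) {T : ℝ} (hT : 0 < T)
    (hw : Function.Periodic w T) (hall : ∀ x, Function.Periodic w x → ∃ n : ℤ, x = n * T) :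
    IsLeastPeriod (fun σ => w σ ^ (1 / q)) T := by
  refine ⟨⟨hT, fun σ => by simp only [hw σ]⟩, fun t ⟨ht, htp⟩ => ?_⟩
  obtain ⟨n, hn⟩ := hall t fun σ => by
    have h1 := htp σ
    exact (rpow_left_inj (hpos _).le (hpos _).le (one_div_pos.2 hq).ne').1 h1
  have h1 : (1 : ℝ) ≤ n := by exact_mod_cast one_le_of_pos_mul hT ht hn
  rw [hn]
  nlinarith

lemma positiveSolutions_of_pos (hq : 0 < q) (hc : 0 < c) :
    ∃ k₁ k₂ : ℕ,
      IsLeast {k : ℕ | √(c + 1) < (k : ℝ)} k₁ ∧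
      IsGreatest {k : ℕ | (k : ℝ) < π / (2 * periodIntegral c)} k₂ ∧
      ∃ ω : ℕ → ℝ → ℝ,
        (∀ k ∈ Icc k₁ k₂, (∀ σ, 0 < ω k σ) ∧ IsLeastPeriod (ω k) (2 * π / k)) ∧
        positiveSolutions 1 q c =
          {fun _ : ℝ => (c + 1) ^ (1 / q)} ∪ ⋃ k ∈ Icc k₁ k₂, rotations (ω k) := by
  have hI := periodIntegral_pos hc
  have hroot : 0 < √(c + 1) := sqrt_pos.2 (by linarith)
  have hX : 0 < π / (2 * periodIntegral c) := by positivity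
  have hex : ∃ k : ℕ, √(c + 1) < (k : ℝ) := exists_nat_gt _
  have hbdd : BddAbove {k : ℕ | (k : ℝ) < π / (2 * periodIntegral c)} :=
    ⟨⌈π / (2 * periodIntegral c)⌉₊, fun k hk => by
      have : (k : ℝ) ≤ ⌈π / (2 * periodIntegral c)⌉₊ := (le_of_lt hk).trans (Nat.le_ceil _)
      exact_mod_cast this⟩
  have hne : {k : ℕ | (k : ℝ) < π / (2 * periodIntegral c)}.Nonempty := ⟨0, by simpa using hX⟩
  obtain ⟨k₁, hk₁⟩ : ∃ k₁, IsLeast {k : ℕ | √(c + 1) < (k : ℝ)} k₁ :=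
    ⟨sInf _, Nat.sInf_mem hex, fun k hk => Nat.sInf_le hk⟩
  obtain ⟨k₂, hk₂⟩ : ∃ k₂, IsGreatest {k : ℕ | (k : ℝ) < π / (2 * periodIntegral c)} k₂ :=
    ⟨sSup _, Nat.sSup_mem hne hbdd, fun k hk => le_csSup hbdd hk⟩
  -- The bounds `k₁` and `k₂` say exactly that `2π / k` lies strictly between the limits of the
  -- period at `y = 0` and `y = 1`.
  have hrange : ∀ k : ℕ, k ∈ Icc k₁ k₂ ↔ 0 < k ∧ 4 * periodIntegral c < 2 * π / k ∧
      2 * π / k < 2 * π / √(c + 1) := by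
    intro k
    constructor
    · rintro ⟨h1, h2⟩
      have h1' : √(c + 1) < (k : ℝ) := lt_of_lt_of_le hk₁.1 (by exact_mod_cast h1)
      have h2' : (k : ℝ) < π / (2 * periodIntegral c) :=
        lt_of_le_of_lt (by exact_mod_cast h2) hk₂.1
      have hk : (0 : ℝ) < k := hroot.trans h1'
      refine ⟨by exact_mod_cast hk, ?_, ?_⟩
      · rw [lt_div_iff₀ (by positivity)] at h2' ⊢
        linarith
      · exact div_lt_div_of_pos_left two_pi_pos hroot h1'
    · rintro ⟨hk, h1, h2⟩
      have hk' : (0 : ℝ) < k := by exact_mod_cast hk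
      refine ⟨hk₁.2 ?_, hk₂.2 ?_⟩
      · exact (div_lt_div_iff_of_pos_left two_pi_pos hk' hroot).1 h2
      · change (k : ℝ) < _
        rw [lt_div_iff₀ (by positivity)] at h1 ⊢
        linarith
  have hprof : ∀ k : ℕ, ∃ (y : ℝ) (w S : ℝ → ℝ), k ∈ Icc k₁ k₂ →
      (0 < y ∧ profilePeriod c y = 2 * π / k) ∧ (∀ σ, IsProfileAt c w S σ) ∧ S 0 = 0 ∧
      w 0 = 1 + c - √((1 + c) ^ 2 - (y + c) ^ 2) ∧
      Function.Periodic w (2 * π / k) ∧ Function.Periodic S (2 * π / k) ∧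
      ∀ x, Function.Periodic w x → ∃ n : ℤ, x = n * (2 * π / k) := by
    intro k
    by_cases hk : k ∈ Icc k₁ k₂
    · obtain ⟨-, h1, h2⟩ := (hrange k).1 hk
      obtain ⟨y, hy, hy1, hyT⟩ := exists_profilePeriod_eq hc h1 h2
      obtain ⟨w, S, h⟩ := exists_profile hy hy1 (by linarith : 0 < y + c)
      rw [hyT] at h
      exact ⟨y, w, S, fun _ => ⟨⟨hy, hyT⟩, h⟩⟩
    · exact ⟨0, 0, 0, fun h => absurd h hk⟩
  choose y w S hP using hprof
  refine ⟨k₁, k₂, hk₁, hk₂, fun k σ => w k σ ^ (1 / q), fun k hk => ?_, ?_⟩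
  · obtain ⟨-, hw, -, -, hwT, -, hall⟩ := hP k hk
    have hk0 : (0 : ℝ) < k := by exact_mod_cast ((hrange k).1 hk).1
    exact ⟨fun σ => rpow_pos_of_pos (hw σ).pos _,
      isLeastPeriod_rpow hq (fun σ => (hw σ).pos) (by positivity) hwT hall⟩
  · refine Subset.antisymm (fun ω hω => ?_)
      (union_subset (singleton_subset_iff.2 ?_) (iUnion₂_subset fun k hk => ?_))
    · rcases positive_trichotomy hq hω with ⟨h1, -⟩ | h1 | ⟨σ₀, z, hz, hz1, hzc, huniq⟩
      · exact absurd h1 hc.ne'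
      · exact Or.inl h1.2
      · right
        obtain ⟨w', S', hw', hS0', hw0', hwT', hST', hall'⟩ := exists_profile hz hz1 hzc
        have hT := profilePeriod_pos hz hz1 hzc
        obtain ⟨n, hn⟩ := hall' _ (huniq w' S' hw' hS0' hw0' _ hT.ne' hwT' hST').2
        have hn1 := one_le_of_pos_mul hT two_pi_pos hn
        lift n to ℕ using by omega
        have hn1' : 0 < n := by exact_mod_cast hn1
        have hn0 : (0 : ℝ) < n := by exact_mod_cast hn1'
        have hTn : profilePeriod c z = 2 * π / n := by
          rw [eq_div_iff hn0.ne', hn]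
          push_cast
          ring
        have hmem : n ∈ Icc k₁ k₂ := by
          refine (hrange n).2 ⟨hn1', ?_, ?_⟩
          · rw [← hTn, ← profilePeriod_zero hc]
            exact profilePeriod_lt hc le_rfl hz
          · rw [← hTn, ← profilePeriod_one hc]
            exact profilePeriod_lt hc hz.le hz1
        obtain ⟨⟨hy, hyT⟩, hw, hS0, hw0, hwT, hST, -⟩ := hP n hmem
        -- Strict monotonicity of the period identifies the parameter of the solution with the one
        -- chosen for `n`.
        have hyz : y n = z := by
          rcases lt_trichotomy (y n) z with h | h | h
          · exact absurd (hyT.trans hTn.symm) (profilePeriod_lt hc hy.le h).ne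
          · exact h
          · exact absurd (hyT.trans hTn.symm) (profilePeriod_lt hc hz.le h).ne'
        rw [hyz] at hw0
        have := (huniq (w n) (S n) hw hS0 hw0 _ (by positivity) hwT hST).1
        simp only [mem_iUnion]
        exact ⟨n, hmem, -σ₀, this.symm⟩
    · exact const_mem_positiveSolutions hq (by linarith)
    · obtain ⟨-, hw, -, -, hwT, -, -⟩ := hP k hk
      have hk0 : (k : ℝ) ≠ 0 := by exact_mod_cast ((hrange k).1 hk).1.ne'
      refine rotations_subset (rpow_mem_positiveSolutions hq hw ?_)
      have := hwT.nat_mul k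
      rwa [mul_div_cancel₀ _ hk0] at this

end NonzeroCoefficient

end SeparableSolutions

/-! ### Assembly of the cases -/

theorem theorem3 (q c : ℝ) (hq : 0 < q) :
    -- sign changing solutions
    ((c ≠ 0 ∨ (c = 0 ∧ 1 < q)) → SeparableSolutions.signChangingSolutions 1 q c = ∅) ∧
    ((c = 0 ∧ q ≤ 1) →
      ContDiff ℝ 1 (SeparableSolutions.omegaZero q) ∧
      SeparableSolutions.IsSolution 1 q c (SeparableSolutions.omegaZero q) ∧
      SeparableSolutions.signChangingSolutions 1 q c =
        SeparableSolutions.rotations (SeparableSolutions.omegaZero q)) ∧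
    -- positive solutions
    (c ≤ -1 → SeparableSolutions.positiveSolutions 1 q c = ∅) ∧
    ((-1 < c ∧ c < 0) →
      SeparableSolutions.positiveSolutions 1 q c = {fun _ : ℝ => (c + 1) ^ (1 / q)}) ∧
    (0 < c →
      ∃ k₁ k₂ : ℕ,
        IsLeast {k : ℕ | √(c + 1) < (k : ℝ)} k₁ ∧
        IsGreatest {k : ℕ | (k : ℝ) < Real.pi / (2 * SeparableSolutions.periodIntegral c)} k₂ ∧
        ∃ ω : ℕ → ℝ → ℝ,
          (∀ k ∈ Set.Icc k₁ k₂, (∀ σ, 0 < ω k σ) ∧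
            SeparableSolutions.IsLeastPeriod (ω k) (2 * Real.pi / k)) ∧
          SeparableSolutions.positiveSolutions 1 q c =
            {fun _ : ℝ => (c + 1) ^ (1 / q)} ∪
              ⋃ k ∈ Set.Icc k₁ k₂, SeparableSolutions.rotations (ω k)) ∧
    ((c = 0 ∧ 1 ≤ q) →
      SeparableSolutions.positiveSolutions 1 q c =
        {fun _ : ℝ => 1} ∪
          ⋃ K ∈ Set.Ioo (0 : ℝ) 1,
            SeparableSolutions.rotations (SeparableSolutions.omegaK q K)) ∧
    ((c = 0 ∧ q < 1) →
      SeparableSolutions.positiveSolutions 1 q c =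
        ({fun _ : ℝ => 1} ∪
          ⋃ K ∈ Set.Ioo (0 : ℝ) 1,
            SeparableSolutions.rotations (SeparableSolutions.omegaK q K)) ∪
          SeparableSolutions.rotations (SeparableSolutions.omegaZeroPos q)) := by
  refine ⟨fun h => ?_, fun ⟨hc, hq1⟩ => ?_, fun h => ?_, fun ⟨h1, h2⟩ => ?_, fun h => ?_,
    fun ⟨hc, hq1⟩ => ?_, fun ⟨hc, hq1⟩ => ?_⟩
  · refine Set.eq_empty_of_forall_notMem fun ω hω => ?_
    obtain ⟨h1, h2, -⟩ := SeparableSolutions.signChanging_classification hq hω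
    rcases h with h | h
    · exact h h1
    · linarith [h.2]
  · subst hc
    exact ⟨SeparableSolutions.contDiff_omegaZero hq hq1,
      SeparableSolutions.isSolution_omegaZero hq hq1,
      SeparableSolutions.signChangingSolutions_eq hq hq1⟩
  · refine Set.eq_empty_of_forall_notMem fun ω hω => ?_
    linarith [(SeparableSolutions.positiveSolutions_of_neg hq (by linarith) hω).1]
  · refine Set.Subset.antisymm
      (fun ω hω => (SeparableSolutions.positiveSolutions_of_neg hq h2 hω).2) ?_
    exact Set.singleton_subset_iff.2 (SeparableSolutions.const_mem_positiveSolutions hq h1)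
  · exact SeparableSolutions.positiveSolutions_of_pos hq h
  · subst hc
    refine Set.Subset.antisymm (fun ω hω => ?_)
      (SeparableSolutions.positiveSolutions_zero_supset hq)
    rcases SeparableSolutions.positiveSolutions_zero_subset hq hω with h | h
    · exact h
    · linarith [h.1]
  · subst hc
    refine Set.Subset.antisymm (fun ω hω => ?_)
      (Set.union_subset (SeparableSolutions.positiveSolutions_zero_supset hq)
        (SeparableSolutions.rotations_subset (SeparableSolutions.omegaZeroPos_mem hq hq1)))
    rcases SeparableSolutions.positiveSolutions_zero_subset hq hω with h | h
    · exact Or.inl h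
    · exact Or.inr h.2
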